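/- **The Lovett–Meka distribution.** Let $1\le n\le m$, let $A\in\mathbb{R}^{m\times n}$ have rows $A_1,\dots,A_m$ and columns $A^1,\dots,A^n$, let $x_0\in[-1,1]^n$, and let $C_1,C_2>0$. Let $\Delta$ be the smallest number $\Delta\ge 0$ with $\sum_{i:\,A_i\ne 0}\exp\big(-C_1\Delta^2/\|A_i\|_2^2\big)\le C_2 n$, and put $$K=\{x\in[-1,1]^n : |\langle A_i,x-x_0\rangle|\le\Delta \text{ for } i=1,\dots,m\}.$$ At a point $x\in K$, a coordinate $j$ is *tight* if $|x_j|=1$, and a constraint $i$ is *tight* if $|\langle A_i,x-x_0\rangle|=\Delta$. Let $V(x)$ be the space of all $y\in\mathbb{R}^n$ with $y_j=0$ for every tight coordinate $j$, $\langle A_i,y\rangle=0$ for every tight constraint $i$, and, if $n\ge 2$, also $\langle x,y\rangle=0$. Consider the random walk that starts at $x_0$ and makes $8n$ steps, where a step from $x$ is as follows. If at least $n/2$ coordinates of $x$ are tight, or if $\dim V(x)\le n/8$, the walk stays at $x$ forever. Otherwise draw $u$ uniformly from the unit sphere of $V(x)$ and an independent uniform sign $\sigma\in\{-1,1\}$,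 let $r=\max\{r\ge 0 : x+ru\in K \text{ and } x-ru\in K\}$, and move to $x+\sigma\min\{1,r\}\,u$. The distribution $\mathcal{D}(A,x_0)$ is the law of the final point of the walk, conditioned on the event that at least $n/2$ of its coordinates are tight. **Theorem.** If the constants $C_1,C_2>0$ are small enough (i.e. $C_1,C_2\le c$ for some universal constant $c>0$), then there is a constant $C>0$, depending only on $C_1$ and $C_2$, such that the following holds for all integers $1\le n\le m$, all $A\in\mathbb{R}^{m\times n}$ and all $x_0\in[-1,1]^n$. The distribution $\mathcal{D}(A,x_0)$ is well defined (the conditioning event has positive probability), and for all $2\le p\le q\le\infty$ such that $\|A^j\|_p\le 1$ for $j=1,\dots,n$, the expectation below is finite and $$\mathbb{E}_{x\sim\mathcal{D}(A,x_0)}\big[\|A(x-x_0)\|_q\big]\le C\,\sqrt{\min\{p,\log(2m/n)\}}\cdot n^{1/2-1/p+1/q},$$ where $1/\infty=0$ and $\min\{\infty,t\}=t$. -/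

import Mathlib

open MeasureTheory
open scoped ENNReal

noncomputable section

namespace LovettMeka

/-- The `ℓ_q` norm on `ℝ^m`, for `q ∈ [1, ∞]` (at `q = ∞` it is the maximum norm). -/
def lqNorm {m : ℕ} (q : ℝ≥0∞) (v : Fin m → ℝ) : ℝ :=
  ‖(WithLp.toLp q v : PiLp q fun _ : Fin m => ℝ)‖

open Classical in
/-- `∑ᵢ exp (-C₁ Δ² / ‖Aᵢ‖₂²)` over the rows `Aᵢ` of `A`. Zero rows contribute `exp (-∞) = 0`. -/
def rowSum {m n : ℕ} (C₁ : ℝ) (A : Matrix (Fin m) (Fin n) ℝ) (Δ : ℝ) : ℝ :=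
  ∑ i : Fin m, if A i = 0 then 0 else Real.exp (-C₁ * (Δ ^ 2 / ∑ j : Fin n, A i j ^ 2))

/-- The smallest `Δ ≥ 0` with `∑ᵢ exp (-C₁ Δ² / ‖Aᵢ‖₂²) ≤ C₂ n`. -/
def radius {m n : ℕ} (C₁ C₂ : ℝ) (A : Matrix (Fin m) (Fin n) ℝ) : ℝ :=
  sInf {Δ : ℝ | 0 ≤ Δ ∧ rowSum C₁ A Δ ≤ C₂ * n}

/-- The entries `⟨Aᵢ, y⟩` of the vector `A y`. -/
def apply {m n : ℕ} (A : Matrix (Fin m) (Fin n) ℝ) (y : EuclideanSpace ℝ (Fin n)) : Fin m → ℝ :=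
  fun i => ∑ j : Fin n, A i j * y j

/-- The polytope `K = {x ∈ [-1,1]^n : |⟨Aᵢ, x - x₀⟩| ≤ Δ for all i}`. -/
def polytope {m n : ℕ} (A : Matrix (Fin m) (Fin n) ℝ) (x₀ : EuclideanSpace ℝ (Fin n)) (Δ : ℝ) :
    Set (EuclideanSpace ℝ (Fin n)) :=
  {x | (∀ j, |x j| ≤ 1) ∧ ∀ i, |apply A (x - x₀) i| ≤ Δ}

/-- At least half of the coordinates of `x` are tight, i.e. equal to `1` or `-1`. -/
def IsPartialColoring {n : ℕ} (x : EuclideanSpace ℝ (Fin n)) : Prop :=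
  n ≤ 2 * Nat.card {j : Fin n // |x j| = 1}

/-- The space of admissible directions at `x`: the vectors `y` that are orthogonal to `x`, to all
tight coordinates and to all tight constraints. For `n = 1` orthogonality to `x` is not required
(it would leave no direction at all). -/
def directions {m n : ℕ} (A : Matrix (Fin m) (Fin n) ℝ) (x₀ : EuclideanSpace ℝ (Fin n)) (Δ : ℝ)
    (x : EuclideanSpace ℝ (Fin n)) : Submodule ℝ (EuclideanSpace ℝ (Fin n)) where
  carrier := {y | (2 ≤ n → ∑ j, y j * x j = 0) ∧ (∀ j, |x j| = 1 → y j = 0) ∧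
    ∀ i, |apply A (x - x₀) i| = Δ → apply A y i = 0}
  zero_mem' := by simp [apply]
  add_mem' := by
    rintro a b ⟨ha1, ha2, ha3⟩ ⟨hb1, hb2, hb3⟩
    refine ⟨fun h => ?_, fun j h => ?_, fun i h => ?_⟩
    · simp [add_mul, Finset.sum_add_distrib, ha1 h, hb1 h]
    · simp [ha2 j h, hb2 j h]
    · have h1 := ha3 i h
      have h2 := hb3 i h
      simp only [apply] at h1 h2
      simp [apply, mul_add, Finset.sum_add_distrib, h1, h2]
  smul_mem' := by
    rintro c a ⟨ha1, ha2, ha3⟩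
    refine ⟨fun h => ?_, fun j h => ?_, fun i h => ?_⟩
    · simp [mul_assoc, ← Finset.mul_sum, ha1 h]
    · simp [ha2 j h]
    · have h1 := ha3 i h
      simp only [apply] at h1
      simp [apply, mul_left_comm, ← Finset.mul_sum, h1]

/-- The walk stops at `x` if `x` is a partial coloring (success), or if the space of admissible
directions has dimension at most `n / 8` (failure). -/
def Stops {m n : ℕ} (A : Matrix (Fin m) (Fin n) ℝ) (x₀ : EuclideanSpace ℝ (Fin n)) (Δ : ℝ)
    (x : EuclideanSpace ℝ (Fin n)) : Prop :=
  IsPartialColoring x ∨ 8 * Module.finrank ℝ (directions A x₀ Δ x) ≤ n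

/-- The direction `P g / ‖P g‖`, with `P` the orthogonal projection onto `V`. If `g` is a standard
Gaussian and `V ≠ 0`, then it is uniformly distributed on the unit sphere of `V`. -/
def direction {n : ℕ} (V : Submodule ℝ (EuclideanSpace ℝ (Fin n)))
    (g : EuclideanSpace ℝ (Fin n)) : EuclideanSpace ℝ (Fin n) :=
  ‖V.starProjection g‖⁻¹ • V.starProjection g

/-- The step length `min {1, r}`, with `r` the largest number such that `x + r u` and `x - r u`
both lie in the polytope. -/
def stepLength {m n : ℕ} (A : Matrix (Fin m) (Fin n) ℝ) (x₀ : EuclideanSpace ℝ (Fin n)) (Δ : ℝ)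
    (x u : EuclideanSpace ℝ (Fin n)) : ℝ :=
  min 1 (sSup {r : ℝ | 0 ≤ r ∧ x + r • u ∈ polytope A x₀ Δ ∧ x - r • u ∈ polytope A x₀ Δ})

open Classical in
/-- One step of the walk from `x`, with Gaussian vector `g` and sign `σ`. -/
def step {m n : ℕ} (A : Matrix (Fin m) (Fin n) ℝ) (x₀ : EuclideanSpace ℝ (Fin n)) (Δ : ℝ)
    (x g : EuclideanSpace ℝ (Fin n)) (σ : ℝ) : EuclideanSpace ℝ (Fin n) :=
  if Stops A x₀ Δ x then x
  else
    let u := direction (directions A x₀ Δ x) g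
    x + (σ * stepLength A x₀ Δ x u) • u

/-- The uniform distribution on `{-1, 1}`. -/
def signMeasure : Measure ℝ :=
  (2⁻¹ : ℝ≥0∞) • Measure.dirac 1 + (2⁻¹ : ℝ≥0∞) • Measure.dirac (-1)

/-- The law of the position of the walk after `t` steps from `x₀`; in every step a fresh
independent pair of a standard Gaussian vector and a uniform sign is used. -/
def walkLaw {m n : ℕ} (A : Matrix (Fin m) (Fin n) ℝ) (x₀ : EuclideanSpace ℝ (Fin n)) (Δ : ℝ) :
    ℕ → Measure (EuclideanSpace ℝ (Fin n))
  | 0 => Measure.dirac x₀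
  | t + 1 =>
    ((walkLaw A x₀ Δ t).prod
      ((ProbabilityTheory.stdGaussian (EuclideanSpace ℝ (Fin n))).prod signMeasure)).map
      fun ω => step A x₀ Δ ω.1 ω.2.1 ω.2.2

/-- The Lovett–Meka distribution `D(A, x₀)` with constants `C₁, C₂`: the law of the walk
after `8 n` steps, conditioned on success. -/
def distribution {m n : ℕ} (C₁ C₂ : ℝ) (A : Matrix (Fin m) (Fin n) ℝ)
    (x₀ : EuclideanSpace ℝ (Fin n)) : Measure (EuclideanSpace ℝ (Fin n)) :=
  ProbabilityTheory.cond (walkLaw A x₀ (radius C₁ C₂ A) (8 * n)) {x | IsPartialColoring x}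

end LovettMeka

end

noncomputable section

namespace LovettMeka

open ProbabilityTheory Module Filter Topology
open scoped RealInnerProductSpace

variable {m n : ℕ}

local notation "E" => EuclideanSpace ℝ (Fin n)

/-! The proof rests on a subgaussian estimate for the walk, a potential that forces it to stop, and
an interpolation between the maximum and the `p`-th moments of `A (x - x₀)`.

A uniform direction in a space of dimension more than `n / 8` has variance proxy at most `8 / n`
(`lintegral_exp_inner_direction_le`). The random signs allow step lengths below `1`, so after `8 n`
steps `⟪a, x - x₀⟫` has variance proxy `64 ‖a‖²`. This gives tails (`walkLaw_tail_le`) and moments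
(`lintegral_abs_rpow_walkLaw_le`).

Success has probability at least `1 / 2` (`walkLaw_isPartialColoring_ge`). `potential` is at most `3
n` and drops by at least `1` in expectation at every step taken before stopping, so the walk is
still running after `8 n` steps with probability at most `3 / 8`. Stopping without success forces at
least `n / 8` nonzero rows to be tight; the tail at `Δ` and the choice of `Δ` make their expected
number at most `n / 64`, so Markov's inequality bounds this event by `1 / 8`.

For the norm, put `B = K √p n^(1/2 - 1/p)`. One estimate of `∑ ‖Aᵢ‖^p` shows both that `Δ ≤ B` and
that `∑ (|⟨Aᵢ, x - x₀⟩| / B)^p` has expectation at most `n`. All entries being at most `B`, the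
`ℓ_q` norm is of order `B n^(1/q)` in expectation, and conditioning at most doubles this. If `p`
exceeds both `2` and `log (2m/n)`, it is replaced by the larger of the two; this costs a factor of
at most `e` (`rpow_mul_rpow_le`). -/

/-! ### Random directions are subgaussian -/

/-- Every vector of a finite-dimensional space has coordinates of equal size in some orthonormal
basis. -/
lemma exists_orthonormalBasis_inner_sq {F : Type*} [NormedAddCommGroup F] [InnerProductSpace ℝ F]
    [FiniteDimensional ℝ F] (w : F) :
    ∃ b : OrthonormalBasis (Fin (finrank ℝ F)) ℝ F,
      ∀ i, ⟪b i, w⟫ ^ 2 = ‖w‖ ^ 2 / finrank ℝ F := by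
  set d := finrank ℝ F with hd
  set b₀ := stdOrthonormalBasis ℝ F
  set v : F := (‖w‖ / √d) • ∑ i, b₀ i with hv
  have hin : ∀ i, ⟪b₀ i, v⟫ = ‖w‖ / √d := by
    intro i
    rw [hv, inner_smul_right, inner_sum]
    simp [b₀.inner_eq_ite]
  rcases Nat.eq_zero_or_pos d with h0 | hpos
  · refine ⟨b₀, fun i => ?_⟩
    have := i.2
    omega
  have hdr : (0 : ℝ) < d := by exact_mod_cast hpos
  have hnorm : ‖v‖ = ‖w‖ := by
    have h1 : ‖v‖ ^ 2 = ‖w‖ ^ 2 := by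
      rw [← b₀.sum_sq_norm_inner_right v]
      simp only [hin, Real.norm_eq_abs, sq_abs]
      rw [Finset.sum_const, Finset.card_univ, Fintype.card_fin, div_pow, Real.sq_sqrt hdr.le,
        nsmul_eq_mul, ← hd]
      field_simp
    exact (pow_left_inj₀ (norm_nonneg _) (norm_nonneg _) two_ne_zero).1 h1
  -- As `v` and `w` have equal norm, the reflection in the bisecting hyperplane carries `v`, whose
  -- coordinates are all equal, to `w`.
  set R := Submodule.reflection (ℝ ∙ (v - w))ᗮ
  have hR : R v = w := Submodule.reflection_sub hnorm
  refine ⟨b₀.map R, fun i => ?_⟩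
  rw [OrthonormalBasis.map_apply, ← hR, LinearIsometryEquiv.inner_map_map, hin, div_pow,
    Real.sq_sqrt hdr.le, hR]

lemma direction_mem (V : Submodule ℝ E) (g : E) : direction V g ∈ V :=
  V.smul_mem _ (V.starProjection_apply_mem g)

lemma norm_direction_le (V : Submodule ℝ E) (g : E) : ‖direction V g‖ ≤ 1 := by
  rw [direction, norm_smul, norm_inv, norm_norm]
  exact inv_mul_le_one

lemma norm_direction {V : Submodule ℝ E} {g : E} (h : V.starProjection g ≠ 0) :
    ‖direction V g‖ = 1 := by
  rw [direction, norm_smul, norm_inv, norm_norm, inv_mul_cancel₀ (norm_ne_zero_iff.2 h)]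

lemma measurable_direction (V : Submodule ℝ E) : Measurable (direction V) := by
  unfold direction
  fun_prop

/-- Reflecting the Gaussian vector in a hyperplane with normal in `V` reflects the direction. -/
lemma direction_reflection (V : Submodule ℝ E) {f : E} (hf : f ∈ V) (g : E) :
    direction V (Submodule.reflection (ℝ ∙ f)ᗮ g) =
      Submodule.reflection (ℝ ∙ f)ᗮ (direction V g) := by
  have key : V.starProjection (Submodule.reflection (ℝ ∙ f)ᗮ g) =
      Submodule.reflection (ℝ ∙ f)ᗮ (V.starProjection g) := by
    rw [Submodule.reflection_orthogonal_apply, Submodule.reflection_orthogonal_apply,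
      Submodule.reflection_singleton_apply, Submodule.reflection_singleton_apply]
    have h1 : V.starProjection f = f := Submodule.starProjection_eq_self_iff.2 hf
    have h2 : ⟪f, V.starProjection g⟫ = ⟪f, g⟫ := by
      rw [← Submodule.inner_starProjection_left_eq_right, h1]
    rw [h2]
    simp [h1]
  rw [direction, key, LinearIsometryEquiv.norm_map, direction, map_smul]

lemma lintegral_comp_isometry (f : E ≃ₗᵢ[ℝ] E) (F : E → ℝ≥0∞) (hF : Measurable F) :
    ∫⁻ g, F (f g) ∂(stdGaussian E) = ∫⁻ g, F g ∂(stdGaussian E) := by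
  conv_rhs => rw [← stdGaussian_map f]
  rw [lintegral_map hF f.continuous.measurable]

/-- A uniformly random direction in `V` is subgaussian with variance proxy `1 / dim V`. -/
lemma lintegral_exp_inner_direction_le (V : Submodule ℝ E) (a : E) :
    ∫⁻ g, ENNReal.ofReal (Real.exp ⟪a, direction V g⟫) ∂(stdGaussian E) ≤
      ENNReal.ofReal (Real.exp (‖a‖ ^ 2 / (2 * finrank ℝ V))) := by
  classical
  set w : V := V.orthogonalProjectionOnto a with hw
  set d := finrank ℝ V with hd
  -- With equal coordinates `t i ^ 2 = ‖w‖² / d`, the final sum `∑ (t i * u i)² / 2` is controlled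
  -- by `∑ (u i)² ≤ 1` alone. This is where the factor `1 / d` comes from.
  obtain ⟨b, hb⟩ : ∃ b : OrthonormalBasis (Fin d) ℝ V, ∀ i, ⟪b i, w⟫ ^ 2 = ‖w‖ ^ 2 / d :=
    exists_orthonormalBasis_inner_sq w
  set t : Fin d → ℝ := fun i => ⟪b i, w⟫
  set u : Fin d → E → ℝ := fun i g => ⟪(b i : E), direction V g⟫ with hu
  have hum : ∀ i, Measurable (u i) := fun i =>
    (measurable_const.inner (measurable_direction V))
  have hrefl : ∀ i j g, u j (Submodule.reflection (ℝ ∙ (b i : E))ᗮ g) =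
      if j = i then - u j g else u j g := by
    intro i j g
    simp only [hu]
    rw [direction_reflection V (b i).2, Submodule.reflection_orthogonal_apply,
      Submodule.reflection_singleton_apply]
    have hbn : ‖((b i : V) : E)‖ = 1 := b.norm_eq_one i
    have hbij : ⟪((b j : V) : E), ((b i : V) : E)⟫ = if j = i then 1 else 0 := by
      rw [← Submodule.coe_inner, b.inner_eq_ite]
    rw [inner_neg_right, inner_sub_right, hbn, two_smul, inner_add_right, inner_smul_right, hbij]
    split_ifs with h
    · subst h; simp
    · simp
  have hinner : ∀ g, ⟪a, direction V g⟫ = ∑ i, t i * u i g := by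
    intro g
    have h1 : ⟪a, direction V g⟫ = ⟪w, (⟨direction V g, direction_mem V g⟩ : V)⟫ := by
      rw [hw, Submodule.inner_orthogonalProjectionOnto_eq_of_mem_right]
    rw [h1, ← b.sum_inner_mul_inner]
    refine Finset.sum_congr rfl fun i _ => ?_
    rw [real_inner_comm]
    rfl
  -- The coordinates `u i` are dependent, but their joint law is invariant under flipping any single
  -- sign. Averaging over the flip of `u i` turns `exp (t i * u i)` into a `cosh`, which is at most
  -- `exp ((t i * u i)² / 2)`; the coordinates are treated one at a time.
  have hstep : ∀ S : Finset (Fin d),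
      ∫⁻ g, ENNReal.ofReal (Real.exp (∑ i, t i * u i g)) ∂(stdGaussian E) ≤
      ∫⁻ g, ENNReal.ofReal (Real.exp (∑ i ∈ S, (t i * u i g) ^ 2 / 2 +
        ∑ i ∈ Sᶜ, t i * u i g)) ∂(stdGaussian E) := by
    intro S
    induction S using Finset.induction_on with
    | empty => simp
    | insert i S hi ih =>
      refine ih.trans ?_
      set Q : E → ℝ := fun g => ∑ j ∈ S, (t j * u j g) ^ 2 / 2 + ∑ j ∈ (insert i S)ᶜ, t j * u j g
        with hQ
      have hQm : Measurable Q := by fun_prop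
      set ρ := Submodule.reflection (ℝ ∙ (b i : E))ᗮ
      have hQρ : ∀ g, Q (ρ g) = Q g := by
        intro g
        simp only [hQ]
        congr 1
        · refine Finset.sum_congr rfl fun j hj => ?_
          rw [hrefl, if_neg (by rintro rfl; exact hi hj)]
        · refine Finset.sum_congr rfl fun j hj => ?_
          rw [hrefl, if_neg (by rintro rfl; simp at hj)]
      have e1 : ∀ g, ∑ j ∈ S, (t j * u j g) ^ 2 / 2 + ∑ j ∈ Sᶜ, t j * u j g =
          Q g + t i * u i g := by
        intro g
        have : Sᶜ = insert i (insert i S)ᶜ := by ext j; by_cases h : j = i <;> simp [h, hi]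
        rw [this, Finset.sum_insert (by simp)]
        simp only [hQ]; ring
      have e2 : ∀ g, ∑ j ∈ insert i S, (t j * u j g) ^ 2 / 2 +
          ∑ j ∈ (insert i S)ᶜ, t j * u j g = Q g + (t i * u i g) ^ 2 / 2 := by
        intro g
        rw [Finset.sum_insert hi]
        simp only [hQ]; ring
      simp only [e1, e2]
      set G : E → ℝ≥0∞ := fun g => ENNReal.ofReal (Real.exp (Q g + t i * u i g)) with hG
      have hGm : Measurable G := by fun_prop
      have h2 : (2 : ℝ≥0∞) * ∫⁻ g, G g ∂(stdGaussian E) =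
          ∫⁻ g, (G g + G (ρ g)) ∂(stdGaussian E) := by
        rw [lintegral_add_left hGm, lintegral_comp_isometry ρ G hGm, two_mul]
      have h3 : ∀ g, G g + G (ρ g) ≤
          2 * ENNReal.ofReal (Real.exp (Q g + (t i * u i g) ^ 2 / 2)) := by
        intro g
        simp only [hG]
        rw [hQρ, hrefl, if_pos rfl, ← ENNReal.ofReal_add (by positivity) (by positivity),
          show (2 : ℝ≥0∞) = ENNReal.ofReal 2 by simp, ← ENNReal.ofReal_mul (by norm_num)]
        apply ENNReal.ofReal_le_ofReal
        have := Real.cosh_le_exp_half_sq (t i * u i g)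
        rw [Real.cosh_eq] at this
        rw [Real.exp_add (Q g), Real.exp_add (Q g), Real.exp_add (Q g), mul_neg]
        have hpos := Real.exp_pos (Q g)
        nlinarith
      have h4 : (2 : ℝ≥0∞) * ∫⁻ g, G g ∂(stdGaussian E) ≤
          2 * ∫⁻ g, ENNReal.ofReal (Real.exp (Q g + (t i * u i g) ^ 2 / 2)) ∂(stdGaussian E) := by
        rw [h2, ← lintegral_const_mul _ (by fun_prop)]
        exact lintegral_mono h3
      exact (ENNReal.mul_le_mul_iff_right (by simp) (by simp)).1 h4
  simp only [hinner]
  refine (hstep Finset.univ).trans ?_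
  have hle : ∀ g, ENNReal.ofReal (Real.exp (∑ i ∈ Finset.univ, (t i * u i g) ^ 2 / 2 +
        ∑ i ∈ (Finset.univ : Finset (Fin d))ᶜ, t i * u i g)) ≤
      ENNReal.ofReal (Real.exp (‖a‖ ^ 2 / (2 * d))) := by
    intro g
    apply ENNReal.ofReal_le_ofReal
    apply Real.exp_le_exp.2
    rw [Finset.compl_univ, Finset.sum_empty, add_zero]
    have h1 : ∀ i, (t i * u i g) ^ 2 / 2 = ‖w‖ ^ 2 / (2 * d) * (u i g) ^ 2 := by
      intro i
      rw [mul_pow, show t i ^ 2 = _ from hb i]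
      ring
    rw [Finset.sum_congr rfl fun i _ => h1 i, ← Finset.mul_sum]
    have h2 : ∑ i, (u i g) ^ 2 ≤ 1 := by
      have h := b.sum_sq_norm_inner_right (⟨direction V g, direction_mem V g⟩ : V)
      have h3 : ‖(⟨direction V g, direction_mem V g⟩ : V)‖ ≤ 1 := norm_direction_le V g
      calc ∑ i, (u i g) ^ 2 = ‖(⟨direction V g, direction_mem V g⟩ : V)‖ ^ 2 := by
            rw [← h]
            refine Finset.sum_congr rfl fun i _ => ?_
            rw [Real.norm_eq_abs, sq_abs]
            rfl
        _ ≤ 1 := pow_le_one₀ (norm_nonneg _) h3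
    have h5 : ‖w‖ ≤ ‖a‖ := by
      rw [hw]; exact V.norm_orthogonalProjectionOnto_apply_le a
    calc ‖w‖ ^ 2 / (2 * d) * ∑ i, (u i g) ^ 2 ≤ ‖w‖ ^ 2 / (2 * d) * 1 := by gcongr
      _ ≤ ‖a‖ ^ 2 / (2 * d) := by rw [mul_one]; gcongr
  calc _ ≤ ∫⁻ g, ENNReal.ofReal (Real.exp (‖a‖ ^ 2 / (2 * d))) ∂(stdGaussian E) :=
        lintegral_mono hle
    _ = _ := by simp

/-- The projection of a Gaussian vector to a nonzero space does not vanish. -/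
lemma ae_starProjection_ne_zero {V : Submodule ℝ E} (hV : V ≠ ⊥) :
    ∀ᵐ g ∂(stdGaussian E), V.starProjection g ≠ 0 := by
  obtain ⟨f, hf, hf0⟩ := V.exists_mem_ne_zero_of_ne_bot hV
  have hL : (stdGaussian E).map (innerSL ℝ f) = gaussianReal 0 (‖f‖ ^ 2).toNNReal := by
    rw [IsGaussian.map_eq_gaussianReal, integral_strongDual_stdGaussian,
      variance_dual_stdGaussian, innerSL_apply_norm]
  have : NullSingletonClass (gaussianReal 0 (‖f‖ ^ 2).toNNReal) :=
    nullSingletonClass_gaussianReal (by simpa using hf0)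
  have h0 : (stdGaussian E) ((innerSL ℝ f) ⁻¹' {0}) = 0 := by
    rw [← Measure.map_apply (innerSL ℝ f).continuous.measurable (measurableSet_singleton 0), hL]
    exact measure_singleton 0
  refine measure_mono_null (fun g hg => ?_) h0
  have hg' : V.starProjection g = 0 := by simpa using hg
  simp only [Set.mem_preimage, innerSL_apply_apply, Set.mem_singleton_iff]
  rw [← (Submodule.starProjection_eq_self_iff.2 hf : V.starProjection f = f),
    Submodule.inner_starProjection_left_eq_right, hg', inner_zero_right]

/-- The rows of `A` as vectors of Euclidean space. -/
def row (A : Matrix (Fin m) (Fin n) ℝ) (i : Fin m) : E := WithLp.toLp 2 (A i)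

lemma apply_eq_inner (A : Matrix (Fin m) (Fin n) ℝ) (y : E) (i : Fin m) :
    apply A y i = ⟪row A i, y⟫ := by
  simp [apply, row, PiLp.inner_apply, mul_comm]

lemma norm_row_sq (A : Matrix (Fin m) (Fin n) ℝ) (i : Fin m) :
    ‖row A i‖ ^ 2 = ∑ j, A i j ^ 2 := by
  simp [row, EuclideanSpace.norm_sq_eq]

lemma row_eq_zero_iff {A : Matrix (Fin m) (Fin n) ℝ} {i : Fin m} : row A i = 0 ↔ A i = 0 := by
  simp [row]

lemma measurable_apply (A : Matrix (Fin m) (Fin n) ℝ) (x₀ : E) (i : Fin m) :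
    Measurable fun x : E => apply A (x - x₀) i := by
  simp only [apply_eq_inner]
  fun_prop

lemma apply_add_smul_sub (A : Matrix (Fin m) (Fin n) ℝ) (x₀ x u : E) (r : ℝ) (i : Fin m) :
    apply A (x + r • u - x₀) i = apply A (x - x₀) i + r * apply A u i := by
  simp only [apply_eq_inner]
  rw [add_sub_right_comm, inner_add_right, inner_smul_right]

/-! ### The space orthogonal to the tight coordinates and constraints -/

/-- The tight coordinates and the tight constraints of a point. -/
def tightPattern (A : Matrix (Fin m) (Fin n) ℝ) (x₀ : E) (Δ : ℝ) (x : E) :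
    (Fin n → Prop) × (Fin m → Prop) :=
  (fun j => |x j| = 1, fun i => |apply A (x - x₀) i| = Δ)

/-- The space orthogonal to a set of coordinates and constraints. -/
def tightSpace (A : Matrix (Fin m) (Fin n) ℝ) (T : (Fin n → Prop) × (Fin m → Prop)) :
    Submodule ℝ E where
  carrier := {y | (∀ j, T.1 j → y j = 0) ∧ ∀ i, T.2 i → apply A y i = 0}
  zero_mem' := by simp [apply]
  add_mem' := by
    rintro a b ⟨ha, ha'⟩ ⟨hb, hb'⟩
    simp only [apply_eq_inner] at *
    exact ⟨fun j h => by simp [ha j h, hb j h],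
      fun i h => by rw [inner_add_right, ha' i h, hb' i h, add_zero]⟩
  smul_mem' := by
    rintro c a ⟨ha, ha'⟩
    simp only [apply_eq_inner] at *
    exact ⟨fun j h => by simp [ha j h], fun i h => by rw [inner_smul_right, ha' i h, mul_zero]⟩

lemma mem_tightSpace {A : Matrix (Fin m) (Fin n) ℝ} {T : (Fin n → Prop) × (Fin m → Prop)} {y : E} :
    y ∈ tightSpace A T ↔ (∀ j, T.1 j → y j = 0) ∧ ∀ i, T.2 i → apply A y i = 0 := Iff.rfl

/-- The additional vector to which directions are orthogonal. -/
def radialPart (x : E) : E := if 2 ≤ n then x else 0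

lemma measurable_radialPart : Measurable (radialPart : E → E) := by
  unfold radialPart
  split_ifs <;> fun_prop

lemma directions_eq (A : Matrix (Fin m) (Fin n) ℝ) (x₀ : E) (Δ : ℝ) (x : E) :
    directions A x₀ Δ x =
      tightSpace A (tightPattern A x₀ Δ x) ⊓ (ℝ ∙ radialPart x)ᗮ := by
  ext y
  rw [Submodule.mem_inf, mem_tightSpace, Submodule.mem_orthogonal_singleton_iff_inner_right,
    and_comm]
  change ((2 ≤ n → _) ∧ _) ↔ _
  refine and_congr ?_ Iff.rfl
  unfold radialPart
  split_ifs with h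
  · simp [h, PiLp.inner_apply]
  · simp [h]

lemma directions_le (A : Matrix (Fin m) (Fin n) ℝ) (x₀ : E) (Δ : ℝ) (x : E) :
    directions A x₀ Δ x ≤ tightSpace A (tightPattern A x₀ Δ x) :=
  directions_eq A x₀ Δ x ▸ inf_le_left

/-- This is a Gram–Schmidt step. It makes the projection onto `directions` explicit in terms of the
discrete tight pattern and of `x`, which yields its measurability. If `W.starProjection z = 0`, the
division by zero gives the correct value. -/
lemma starProjection_inf_orthogonal (W : Submodule ℝ E) (z g : E) :
    (W ⊓ (ℝ ∙ z)ᗮ).starProjection g = W.starProjection g -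
      (⟪W.starProjection z, g⟫ / ‖W.starProjection z‖ ^ 2) • W.starProjection z := by
  set w := W.starProjection z with hw
  have hwW : w ∈ W := W.starProjection_apply_mem z
  have hz : ∀ y ∈ W, ⟪z, y⟫ = ⟪w, y⟫ := by
    intro y hy
    rw [hw, Submodule.inner_starProjection_left_eq_right, Submodule.starProjection_eq_self_iff.2 hy]
  have hg : ∀ y ∈ W, ⟪g, y⟫ = ⟪W.starProjection g, y⟫ := by
    intro y hy
    rw [Submodule.inner_starProjection_left_eq_right, Submodule.starProjection_eq_self_iff.2 hy]
  apply Submodule.eq_starProjection_of_mem_of_inner_eq_zero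
  · have hmem : W.starProjection g - (⟪w, g⟫ / ‖w‖ ^ 2) • w ∈ W :=
      W.sub_mem (W.starProjection_apply_mem g) (W.smul_mem _ hwW)
    refine ⟨hmem, ?_⟩
    rw [SetLike.mem_coe, Submodule.mem_orthogonal_singleton_iff_inner_right, hz _ hmem,
      inner_sub_right, inner_smul_right, real_inner_self_eq_norm_sq]
    rw [← Submodule.inner_starProjection_left_eq_right, Submodule.starProjection_eq_self_iff.2 hwW]
    by_cases h : w = 0
    · simp [h]
    · have : ‖w‖ ≠ 0 := norm_ne_zero_iff.2 h
      field_simp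
      ring
  · intro y hy
    obtain ⟨hyW, hyz⟩ := Submodule.mem_inf.1 hy
    rw [Submodule.mem_orthogonal_singleton_iff_inner_right, hz y hyW] at hyz
    rw [inner_sub_left, inner_sub_left, inner_smul_left, hyz, hg y hyW]
    simp

-- On `W`, orthogonality to `z` is orthogonality to its projection, so at most one dimension is
-- lost.
open Classical in
lemma finrank_inf_orthogonal (W : Submodule ℝ E) (z : E) :
    finrank ℝ (W ⊓ (ℝ ∙ z)ᗮ : Submodule ℝ E) + (if W.starProjection z = 0 then 0 else 1) =
      finrank ℝ W := by
  set w := W.starProjection z with hw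
  have hwW : w ∈ W := W.starProjection_apply_mem z
  have hE : W ⊓ (ℝ ∙ z)ᗮ = (ℝ ∙ w)ᗮ ⊓ W := by
    ext y
    rw [Submodule.mem_inf, Submodule.mem_inf, and_comm,
      Submodule.mem_orthogonal_singleton_iff_inner_right,
      Submodule.mem_orthogonal_singleton_iff_inner_right]
    refine and_congr_left fun hy => ?_
    rw [hw, Submodule.inner_starProjection_left_eq_right, Submodule.starProjection_eq_self_iff.2 hy]
  have hle : (ℝ ∙ w) ≤ W := (Submodule.span_singleton_le_iff_mem _ _).2 hwW
  rw [hE, ← Submodule.finrank_add_inf_finrank_orthogonal hle, add_comm]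
  congr 1
  split_ifs with h
  · rw [h, Submodule.span_zero_singleton, finrank_bot]
  · rw [finrank_span_singleton h]

/-- Rank–nullity for the map collecting all tight conditions. Zero rows impose no condition and are
left out, although they count as tight when `Δ = 0`. -/
lemma finrank_tightSpace_ge (A : Matrix (Fin m) (Fin n) ℝ)
    (T : (Fin n → Prop) × (Fin m → Prop)) :
    n ≤ finrank ℝ (tightSpace A T) + Nat.card {j // T.1 j} +
      Nat.card {i // A i ≠ 0 ∧ T.2 i} := by
  classical
  let f : E →ₗ[ℝ] ({j // T.1 j} → ℝ) × ({i // A i ≠ 0 ∧ T.2 i} → ℝ) :=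
    LinearMap.prod
      (LinearMap.pi fun j => (innerSL ℝ (EuclideanSpace.single j.1 (1 : ℝ))).toLinearMap)
      (LinearMap.pi fun i => (innerSL ℝ (row A i.1)).toLinearMap)
  have hker : LinearMap.ker f = tightSpace A T := by
    ext y
    rw [LinearMap.mem_ker, mem_tightSpace]
    rw [LinearMap.prod_apply, Prod.mk_eq_zero, funext_iff, funext_iff, Subtype.forall,
      Subtype.forall]
    simp only [apply_eq_inner]
    refine and_congr ?_ ?_
    · simp [EuclideanSpace.inner_single_left]
    · refine ⟨fun h i hi => ?_, fun h i hi => by simpa using h i hi.2⟩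
      by_cases h0 : A i = 0
      · rw [row_eq_zero_iff.2 h0, inner_zero_left]
      · simpa using h i ⟨h0, hi⟩
  have h1 := f.finrank_range_add_finrank_ker
  have h2 := (LinearMap.range f).finrank_le
  rw [hker] at h1
  rw [finrank_prod, finrank_pi, finrank_pi] at h2
  rw [finrank_euclideanSpace_fin] at h1
  simp only [Nat.card_eq_fintype_card]
  omega

/-- If the walk fails at `x`, then many nonzero constraints are tight. -/
lemma card_tight_ge_of_stops {A : Matrix (Fin m) (Fin n) ℝ} {x₀ : E} {Δ : ℝ} {x : E} (hn : 1 ≤ n)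
    (hs : Stops A x₀ Δ x) (hx : ¬ IsPartialColoring x) :
    n ≤ 8 * Nat.card {i // A i ≠ 0 ∧ |apply A (x - x₀) i| = Δ} := by
  classical
  have h1 := hs.resolve_left hx
  have h2 := finrank_tightSpace_ge A (tightPattern A x₀ Δ x)
  have h3 := finrank_inf_orthogonal (tightSpace A (tightPattern A x₀ Δ x)) (radialPart x)
  rw [← directions_eq] at h3
  simp only [IsPartialColoring] at hx
  change n ≤ _ + Nat.card {j // |x j| = 1} +
    Nat.card {i // A i ≠ 0 ∧ |apply A (x - x₀) i| = Δ} at h2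
  -- Orthogonality to `x` costs one dimension. The count then gives `8 N ≥ 8 n - 4 (n - 1) - n - 8 =
  -- 3 n - 4` for the number `N` of tight nonzero rows, which is at least `n` exactly when `n ≥ 2`.
  -- For `n = 1` that dimension is not lost.
  by_cases h : 2 ≤ n
  · have h4 : finrank ℝ (tightSpace A (tightPattern A x₀ Δ x)) ≤
        finrank ℝ (directions A x₀ Δ x) + 1 := by
      rw [← h3]
      split_ifs <;> omega
    omega
  · have hr : radialPart x = 0 := if_neg h
    rw [hr, map_zero, if_pos rfl] at h3
    omega

lemma tightSpace_anti {A : Matrix (Fin m) (Fin n) ℝ} {T T' : (Fin n → Prop) × (Fin m → Prop)}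
    (h : T ≤ T') : tightSpace A T' ≤ tightSpace A T :=
  fun _ hy => ⟨fun j hj => hy.1 j (h.1 j hj), fun i hi => hy.2 i (h.2 i hi)⟩

lemma tightPattern_le {A : Matrix (Fin m) (Fin n) ℝ} {x₀ : E} {Δ : ℝ} {x u : E}
    (hu : u ∈ tightSpace A (tightPattern A x₀ Δ x)) (r : ℝ) :
    tightPattern A x₀ Δ x ≤ tightPattern A x₀ Δ (x + r • u) := by
  refine ⟨fun j hj => ?_, fun i hi => ?_⟩
  · have h1 := hu.1 j hj
    simp only [tightPattern] at hj ⊢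
    simpa [h1] using hj
  · have h1 := hu.2 i hi
    simp only [tightPattern] at hi ⊢
    rw [apply_add_smul_sub, h1]
    simpa using hi

/-! ### The polytope and the step length -/

lemma isClosed_polytope (A : Matrix (Fin m) (Fin n) ℝ) (x₀ : E) (Δ : ℝ) :
    IsClosed (polytope A x₀ Δ) := by
  simp only [polytope, apply_eq_inner, Set.ofPred_and, Set.ofPred_forall]
  refine (isClosed_iInter fun j => ?_).inter (isClosed_iInter fun i => ?_)
  · exact isClosed_le (by fun_prop) continuous_const
  · exact isClosed_le (by fun_prop) continuous_const

lemma convex_polytope (A : Matrix (Fin m) (Fin n) ℝ) (x₀ : E) (Δ : ℝ) :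
    Convex ℝ (polytope A x₀ Δ) := by
  intro x hx y hy a b ha hb hab
  have key : ∀ p q c : ℝ, |p| ≤ c → |q| ≤ c → |a * p + b * q| ≤ c := by
    intro p q c hp hq
    calc |a * p + b * q| ≤ |a * p| + |b * q| := abs_add_le _ _
      _ = a * |p| + b * |q| := by rw [abs_mul, abs_mul, abs_of_nonneg ha, abs_of_nonneg hb]
      _ ≤ a * c + b * c := by gcongr
      _ = c := by rw [← add_mul, hab, one_mul]
  refine ⟨fun j => ?_, fun i => ?_⟩
  · simpa using key _ _ _ (hx.1 j) (hy.1 j)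
  · have h := key _ _ _ (hx.2 i) (hy.2 i)
    have e : a • x + b • y - x₀ = a • (x - x₀) + b • (y - x₀) := by
      rw [smul_sub, smul_sub, sub_add_sub_comm, ← add_smul, hab, one_smul]
    rw [e]
    simp only [apply_eq_inner] at h ⊢
    rwa [inner_add_right, inner_smul_right, inner_smul_right]

lemma norm_sq_le_of_mem_polytope {A : Matrix (Fin m) (Fin n) ℝ} {x₀ : E} {Δ : ℝ} {x : E}
    (hx : x ∈ polytope A x₀ Δ) : ‖x‖ ^ 2 ≤ n := by
  rw [EuclideanSpace.norm_sq_eq]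
  calc ∑ i, ‖x i‖ ^ 2 ≤ ∑ _i : Fin n, (1 : ℝ) :=
        Finset.sum_le_sum fun i _ => pow_le_one₀ (norm_nonneg _) (hx.1 i)
    _ = n := by simp

/-- The step lengths that keep both possible new positions in the polytope. -/
def stepSet (A : Matrix (Fin m) (Fin n) ℝ) (x₀ : E) (Δ : ℝ) (x u : E) : Set ℝ :=
  {r : ℝ | 0 ≤ r ∧ x + r • u ∈ polytope A x₀ Δ ∧ x - r • u ∈ polytope A x₀ Δ}

lemma stepLength_eq (A : Matrix (Fin m) (Fin n) ℝ) (x₀ : E) (Δ : ℝ) (x u : E) :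
    stepLength A x₀ Δ x u = min 1 (sSup (stepSet A x₀ Δ x u)) := rfl

lemma stepLength_nonneg (A : Matrix (Fin m) (Fin n) ℝ) (x₀ : E) (Δ : ℝ) (x u : E) :
    0 ≤ stepLength A x₀ Δ x u :=
  le_min zero_le_one (Real.sSup_nonneg fun _ h => h.1)

lemma stepLength_le_one (A : Matrix (Fin m) (Fin n) ℝ) (x₀ : E) (Δ : ℝ) (x u : E) :
    stepLength A x₀ Δ x u ≤ 1 := min_le_left _ _

lemma isClosed_stepSet (A : Matrix (Fin m) (Fin n) ℝ) (x₀ : E) (Δ : ℝ) (x u : E) :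
    IsClosed (stepSet A x₀ Δ x u) := by
  refine (isClosed_le continuous_const continuous_id).inter (IsClosed.inter ?_ ?_)
  · exact (isClosed_polytope A x₀ Δ).preimage (f := fun r : ℝ => x + r • u) (by fun_prop)
  · exact (isClosed_polytope A x₀ Δ).preimage (f := fun r : ℝ => x - r • u) (by fun_prop)

lemma bddAbove_stepSet (A : Matrix (Fin m) (Fin n) ℝ) (x₀ : E) (Δ : ℝ) (x : E) {u : E}
    (hu : u ≠ 0) : BddAbove (stepSet A x₀ Δ x u) := by
  obtain ⟨j, hj⟩ : ∃ j, u j ≠ 0 := by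
    by_contra! h
    exact hu (by ext j; simpa using h j)
  refine ⟨1 / |u j|, fun r hr => ?_⟩
  rw [le_div_iff₀ (abs_pos.2 hj)]
  have h1 := hr.2.1.1 j
  have h2 := hr.2.2.1 j
  simp only [PiLp.add_apply, PiLp.sub_apply, PiLp.smul_apply, smul_eq_mul] at h1 h2
  rw [← abs_of_nonneg hr.1, ← abs_mul]
  rw [abs_le] at *
  constructor <;> linarith

/-- By convexity the polytope contains the whole segment between the two end points `x ± r • u`. -/
lemma mem_stepSet_of_le {A : Matrix (Fin m) (Fin n) ℝ} {x₀ : E} {Δ : ℝ} {x u : E} {r s : ℝ}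
    (hr : r ∈ stepSet A x₀ Δ x u) (hs0 : 0 ≤ s) (hs : s ≤ r) : s ∈ stepSet A x₀ Δ x u := by
  rcases hr.1.eq_or_lt with h0 | h0
  · rwa [show s = r by linarith]
  have e : ∀ c : ℝ, x + (c * r) • u ∈ segment ℝ (x - r • u) (x + r • u) ∨ 1 < |c| := by
    intro c
    by_cases hc : |c| ≤ 1
    · left
      rw [abs_le] at hc
      refine ⟨(1 - c) / 2, (1 + c) / 2, by linarith, by linarith, by ring, ?_⟩
      module
    · right; exact not_le.1 hc
  have hconv := (convex_polytope A x₀ Δ).segment_subset hr.2.2 hr.2.1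
  have hle : |s / r| ≤ 1 := by
    rw [abs_of_nonneg (by positivity), div_le_one h0]
    exact hs
  have hsr : s / r * r = s := by field_simp
  refine ⟨hs0, ?_, ?_⟩
  · have := hconv ((e (s / r)).resolve_right hle.not_gt)
    rwa [hsr] at this
  · have := hconv ((e (-(s / r))).resolve_right (by rw [abs_neg]; exact hle.not_gt))
    rwa [neg_mul, hsr, neg_smul, ← sub_eq_add_neg] at this

lemma zero_mem_stepSet {A : Matrix (Fin m) (Fin n) ℝ} {x₀ : E} {Δ : ℝ} {x : E}
    (hx : x ∈ polytope A x₀ Δ) (u : E) : 0 ∈ stepSet A x₀ Δ x u := by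
  simp [stepSet, hx]

lemma sSup_mem_stepSet {A : Matrix (Fin m) (Fin n) ℝ} {x₀ : E} {Δ : ℝ} {x u : E}
    (hx : x ∈ polytope A x₀ Δ) (hu : u ≠ 0) :
    sSup (stepSet A x₀ Δ x u) ∈ stepSet A x₀ Δ x u :=
  (isClosed_stepSet A x₀ Δ x u).csSup_mem ⟨0, zero_mem_stepSet hx u⟩ (bddAbove_stepSet A x₀ Δ x hu)

lemma stepLength_mem_stepSet {A : Matrix (Fin m) (Fin n) ℝ} {x₀ : E} {Δ : ℝ} {x : E}
    (hx : x ∈ polytope A x₀ Δ) (u : E) : stepLength A x₀ Δ x u ∈ stepSet A x₀ Δ x u := by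
  by_cases hu : u = 0
  · refine ⟨stepLength_nonneg A x₀ Δ x u, ?_⟩
    simpa [hu] using hx
  · exact mem_stepSet_of_le (sSup_mem_stepSet hx hu) (stepLength_nonneg A x₀ Δ x u)
      (min_le_right _ _)

/-- Describes the superlevel sets of the step length by closed conditions on `(x, u)` and `u ≠ 0`,
for measurability. The condition `u ≠ 0` reflects the convention that `sSup` is `0` on a set
unbounded above, which is what `stepSet` is for `u = 0` and `x` in the polytope. -/
lemma le_stepLength_iff {A : Matrix (Fin m) (Fin n) ℝ} {x₀ : E} {Δ : ℝ} {x u : E} {c : ℝ}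
    (hc0 : 0 < c) (hc1 : c ≤ 1) :
    c ≤ stepLength A x₀ Δ x u ↔ u ≠ 0 ∧ c ∈ stepSet A x₀ Δ x u := by
  rw [stepLength_eq, le_min_iff, and_iff_right hc1]
  constructor
  · intro h
    have hpos : 0 < sSup (stepSet A x₀ Δ x u) := hc0.trans_le h
    have hne : (stepSet A x₀ Δ x u).Nonempty := by
      by_contra h'
      rw [Set.not_nonempty_iff_eq_empty.1 h', Real.sSup_empty] at hpos
      exact hpos.false
    have hbdd : BddAbove (stepSet A x₀ Δ x u) := by
      by_contra h'
      rw [Real.sSup_of_not_bddAbove h'] at hpos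
      exact hpos.false
    have hmem := (isClosed_stepSet A x₀ Δ x u).csSup_mem hne hbdd
    refine ⟨?_, mem_stepSet_of_le hmem hc0.le h⟩
    rintro rfl
    obtain ⟨b, hb⟩ := hbdd
    have hx : x ∈ polytope A x₀ Δ := by simpa using hmem.2.1
    have : |b| + 1 ∈ stepSet A x₀ Δ x 0 := ⟨by positivity, by simpa using hx, by simpa using hx⟩
    have := hb this
    linarith [le_abs_self b]
  · rintro ⟨hu, h⟩
    exact le_csSup (bddAbove_stepSet A x₀ Δ x hu) h

lemma measurable_stepLength (A : Matrix (Fin m) (Fin n) ℝ) (x₀ : E) (Δ : ℝ) :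
    Measurable fun z : E × E => stepLength A x₀ Δ z.1 z.2 := by
  refine measurable_of_Ici fun c => ?_
  rcases le_or_gt c 0 with h0 | h0
  · convert MeasurableSet.univ
    exact Set.eq_univ_of_forall fun z => h0.trans (stepLength_nonneg A x₀ Δ z.1 z.2)
  rcases le_or_gt c 1 with h1 | h1
  · have : (fun z : E × E => stepLength A x₀ Δ z.1 z.2) ⁻¹' Set.Ici c =
        {z : E × E | z.2 ≠ 0} ∩ ({z : E × E | z.1 + c • z.2 ∈ polytope A x₀ Δ} ∩
          {z : E × E | z.1 - c • z.2 ∈ polytope A x₀ Δ}) := by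
      ext z
      rw [Set.mem_preimage, Set.mem_Ici, le_stepLength_iff h0 h1]
      simp [stepSet, h0.le]
    rw [this]
    have hK := (isClosed_polytope A x₀ Δ).measurableSet
    refine MeasurableSet.inter ?_ (MeasurableSet.inter ?_ ?_)
    · exact (measurableSet_singleton (0 : E)).compl.preimage measurable_snd
    · exact hK.preimage (f := fun z : E × E => z.1 + c • z.2) (by fun_prop)
    · exact hK.preimage (f := fun z : E × E => z.1 - c • z.2) (by fun_prop)
  · convert MeasurableSet.empty
    refine Set.eq_empty_of_forall_notMem fun z hz => ?_
    have := stepLength_le_one A x₀ Δ z.1 z.2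
    have hz' : c ≤ stepLength A x₀ Δ z.1 z.2 := hz
    linarith

lemma eventually_abs_add_mul_le {a d b r : ℝ} (h : |a + r * d| ≤ b)
    (h' : d ≠ 0 → |a + r * d| ≠ b) : ∀ᶠ s in 𝓝[>] r, |a + s * d| ≤ b := by
  by_cases hd : d = 0
  · simpa [hd] using h
  · have hc : ContinuousAt (fun s : ℝ => |a + s * d|) r := by fun_prop
    exact ((hc.eventually_lt_const (h.lt_of_ne (h' hd))).mono fun _ h => h.le).filter_mono
      nhdsWithin_le_nhds

/-- If a step is shorter than `1`, then one of its two possible end points has a new tight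
coordinate or constraint. -/
lemma notMem_tightSpace_of_stepLength_lt_one {A : Matrix (Fin m) (Fin n) ℝ} {x₀ : E} {Δ : ℝ}
    {x u : E} (hx : x ∈ polytope A x₀ Δ) (hu : u ≠ 0) (h : stepLength A x₀ Δ x u < 1) :
    u ∉ tightSpace A (tightPattern A x₀ Δ (x + stepLength A x₀ Δ x u • u)) ∨
      u ∉ tightSpace A (tightPattern A x₀ Δ (x + (-stepLength A x₀ Δ x u) • u)) := by
  by_contra! hcon
  obtain ⟨h1, h2⟩ := hcon
  have hr : stepLength A x₀ Δ x u = sSup (stepSet A x₀ Δ x u) := by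
    rw [stepLength_eq] at h ⊢
    exact min_eq_right (by by_contra! h'; rw [min_eq_left h'.le] at h; exact h.false)
  set r := stepLength A x₀ Δ x u with hrdef
  have hmem : r ∈ stepSet A x₀ Δ x u := stepLength_mem_stepSet hx u
  have hplus := hmem.2.1
  have hminus := hmem.2.2
  rw [sub_eq_add_neg, ← neg_smul] at hminus
  -- Conditions tight at `x + r • v` do not change along `v`, and the remaining ones have slack, so
  -- one can move slightly further. Doing this for both `u` and `-u` would contradict the maximality
  -- of `r`.
  have key : ∀ v : E, x + r • v ∈ polytope A x₀ Δ →
      v ∈ tightSpace A (tightPattern A x₀ Δ (x + r • v)) →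
      ∀ᶠ s in 𝓝[>] r, x + s • v ∈ polytope A x₀ Δ := by
    intro v hv1 hv2
    have c1 : ∀ᶠ s in 𝓝[>] r, ∀ j, |x j + s * v j| ≤ 1 := by
      rw [eventually_all]
      intro j
      refine eventually_abs_add_mul_le (by simpa using hv1.1 j) fun hne heq => hne ?_
      exact hv2.1 j (by simpa [tightPattern] using heq)
    have c2 : ∀ᶠ s in 𝓝[>] r, ∀ i, |apply A (x - x₀) i + s * apply A v i| ≤ Δ := by
      rw [eventually_all]
      intro i
      refine eventually_abs_add_mul_le ?_ fun hne heq => hne ?_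
      · rw [← apply_add_smul_sub]; exact hv1.2 i
      · refine hv2.2 i ?_
        simp only [tightPattern]
        rw [apply_add_smul_sub]; exact heq
    filter_upwards [c1, c2] with s hs1 hs2
    refine ⟨fun j => by simpa using hs1 j, fun i => ?_⟩
    rw [apply_add_smul_sub]
    exact hs2 i
  have e1 := key u hplus h1
  have e2 := key (-u) (by simpa using hminus) (by simpa using h2)
  obtain ⟨s, ⟨hs1, hs2⟩, hs3⟩ := ((e1.and e2).and self_mem_nhdsWithin).exists
  have hs3' : r < s := hs3
  have hsmem : s ∈ stepSet A x₀ Δ x u :=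
    ⟨hmem.1.trans hs3'.le, hs1, by rwa [smul_neg, ← sub_eq_add_neg] at hs2⟩
  have := le_csSup (bddAbove_stepSet A x₀ Δ x hu) hsmem
  linarith

/-! ### Measurability of the step -/

lemma measurable_tightPattern (A : Matrix (Fin m) (Fin n) ℝ) (x₀ : E) (Δ : ℝ) :
    Measurable (tightPattern A x₀ Δ) := by
  refine Measurable.prodMk (measurable_pi_lambda _ fun j => ?_) (measurable_pi_lambda _ fun i => ?_)
  · exact measurableSet_setOfPred.1
      (measurableSet_eq_fun (f := fun x : E => |x j|) (by fun_prop) measurable_const)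
  · exact measurableSet_setOfPred.1 (measurableSet_eq_fun (measurable_apply A x₀ i).abs measurable_const)

lemma measurableSet_isPartialColoring : MeasurableSet {x : E | IsPartialColoring x} := by
  have : {x : E | IsPartialColoring x} = (fun x : E => fun j => |x j| = 1) ⁻¹'
      {T : Fin n → Prop | n ≤ 2 * Nat.card {j // T j}} := rfl
  rw [this]
  have hm : Measurable (fun x : E => fun j => |x j| = 1) :=
    (measurable_tightPattern (0 : Matrix (Fin 0) (Fin n) ℝ) 0 0).fst
  exact hm (Set.to_countable _).measurableSet

/-- The space depends on the point only through its pattern, which takes countably many values; for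
each fixed pattern the projection is continuous. -/
lemma measurable_starProjection_tightSpace (A : Matrix (Fin m) (Fin n) ℝ) (x₀ : E) (Δ : ℝ)
    {α : Type*} [MeasurableSpace α] {f g : α → E} (hf : Measurable f) (hg : Measurable g) :
    Measurable fun z => (tightSpace A (tightPattern A x₀ Δ (f z))).starProjection (g z) := by
  have h : Measurable fun z : ((Fin n → Prop) × (Fin m → Prop)) × E =>
      (tightSpace A z.1).starProjection z.2 :=
    measurable_from_prod_countable_right fun T =>
      (tightSpace A T).starProjection.continuous.measurable
  have key := h.comp (((measurable_tightPattern A x₀ Δ).comp hf).prodMk hg)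
  simp only [Function.comp_def] at key
  exact key

lemma measurableSet_stops (A : Matrix (Fin m) (Fin n) ℝ) (x₀ : E) (Δ : ℝ) :
    MeasurableSet {x : E | Stops A x₀ Δ x} := by
  classical
  refine measurableSet_isPartialColoring.union ?_
  have hd : ∀ x : E, finrank ℝ (directions A x₀ Δ x) =
      finrank ℝ (tightSpace A (tightPattern A x₀ Δ x)) -
        (if (tightSpace A (tightPattern A x₀ Δ x)).starProjection (radialPart x) = 0
          then 0 else 1) := by
    intro x
    have := finrank_inf_orthogonal (tightSpace A (tightPattern A x₀ Δ x)) (radialPart x)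
    rw [← directions_eq] at this
    omega
  have hm : Measurable fun x : E => finrank ℝ (directions A x₀ Δ x) := by
    simp only [hd]
    refine Measurable.sub ?_ ?_
    · exact (measurable_of_countable fun T => finrank ℝ (tightSpace A T)).comp
        (measurable_tightPattern A x₀ Δ)
    · refine Measurable.ite ?_ measurable_const measurable_const
      exact measurableSet_eq_fun
        (measurable_starProjection_tightSpace A x₀ Δ measurable_id measurable_radialPart)
        measurable_const
  exact hm (Set.to_countable {k : ℕ | 8 * k ≤ n}).measurableSet

lemma measurable_starProjection_directions (A : Matrix (Fin m) (Fin n) ℝ) (x₀ : E) (Δ : ℝ) :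
    Measurable fun z : E × E × ℝ => (directions A x₀ Δ z.1).starProjection z.2.1 := by
  have hw : Measurable fun z : E × E × ℝ =>
      (tightSpace A (tightPattern A x₀ Δ z.1)).starProjection (radialPart z.1) :=
    measurable_starProjection_tightSpace A x₀ Δ measurable_fst
      (measurable_radialPart.comp measurable_fst)
  have hg : Measurable fun z : E × E × ℝ =>
      (tightSpace A (tightPattern A x₀ Δ z.1)).starProjection z.2.1 :=
    measurable_starProjection_tightSpace A x₀ Δ measurable_fst (by fun_prop)
  simp only [directions_eq, starProjection_inf_orthogonal]
  have h3 := ((hw.inner measurable_snd.fst).div (hw.norm.pow_const 2)).smul hw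
  have h4 := hg.sub h3
  exact h4

lemma measurable_direction_directions (A : Matrix (Fin m) (Fin n) ℝ) (x₀ : E) (Δ : ℝ) :
    Measurable fun z : E × E × ℝ => direction (directions A x₀ Δ z.1) z.2.1 := by
  have := measurable_starProjection_directions A x₀ Δ
  unfold direction
  exact this.norm.inv.smul this

lemma measurable_stepLength_direction (A : Matrix (Fin m) (Fin n) ℝ) (x₀ : E) (Δ : ℝ) :
    Measurable fun z : E × E × ℝ =>
      stepLength A x₀ Δ z.1 (direction (directions A x₀ Δ z.1) z.2.1) := by
  have key := (measurable_stepLength A x₀ Δ).comp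
    (measurable_fst.prodMk (measurable_direction_directions A x₀ Δ))
  simp only [Function.comp_def] at key
  exact key

/-- This is essential and not cosmetic: `Measure.map` is zero for a map that is not almost
everywhere measurable, so `walkLaw` has total mass `1` only because of it. -/
lemma measurable_step (A : Matrix (Fin m) (Fin n) ℝ) (x₀ : E) (Δ : ℝ) :
    Measurable fun z : E × E × ℝ => step A x₀ Δ z.1 z.2.1 z.2.2 := by
  have hu := measurable_direction_directions A x₀ Δ
  have hl := measurable_stepLength_direction A x₀ Δ
  have hstep : Measurable fun z : E × E × ℝ =>
      z.1 + (z.2.2 * stepLength A x₀ Δ z.1 (direction (directions A x₀ Δ z.1) z.2.1)) •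
        direction (directions A x₀ Δ z.1) z.2.1 :=
    measurable_fst.add ((measurable_snd.snd.mul hl).smul hu)
  have hstops : MeasurableSet {z : E × E × ℝ | Stops A x₀ Δ z.1} :=
    (measurableSet_stops A x₀ Δ).preimage measurable_fst
  exact Measurable.ite hstops measurable_fst hstep

/-! ### The law of the walk -/

instance : IsProbabilityMeasure signMeasure :=
  ⟨by simp [signMeasure, ENNReal.inv_two_add_inv_two]⟩

instance isProbabilityMeasure_walkLaw (A : Matrix (Fin m) (Fin n) ℝ) (x₀ : E) (Δ : ℝ) (t : ℕ) :
    IsProbabilityMeasure (walkLaw A x₀ Δ t) := by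
  induction t with
  | zero => exact Measure.dirac.isProbabilityMeasure
  | succ t ih => exact Measure.isProbabilityMeasure_map (measurable_step A x₀ Δ).aemeasurable

lemma lintegral_walkLaw_succ (A : Matrix (Fin m) (Fin n) ℝ) (x₀ : E) (Δ : ℝ) (t : ℕ)
    {F : E → ℝ≥0∞} (hF : Measurable F) :
    ∫⁻ y, F y ∂(walkLaw A x₀ Δ (t + 1)) =
      ∫⁻ x, ∫⁻ g, 2⁻¹ * (F (step A x₀ Δ x g 1) + F (step A x₀ Δ x g (-1)))
        ∂(stdGaussian E) ∂(walkLaw A x₀ Δ t) := by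
  have hstep := measurable_step A x₀ Δ
  have hFs : Measurable fun z : E × E × ℝ => F (step A x₀ Δ z.1 z.2.1 z.2.2) := by
    have key := hF.comp hstep
    simp only [Function.comp_def] at key
    exact key
  rw [walkLaw, lintegral_map hF hstep, lintegral_prod _ hFs.aemeasurable]
  refine lintegral_congr fun x => ?_
  have hx : Measurable fun z : E × ℝ => F (step A x₀ Δ x z.1 z.2) := by
    have key := hFs.comp (measurable_prodMk_left (x := x))
    simp only [Function.comp_def] at key
    exact key
  rw [lintegral_prod _ hx.aemeasurable]
  refine lintegral_congr fun g => ?_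
  rw [signMeasure, lintegral_add_measure, lintegral_smul_measure, lintegral_smul_measure,
    lintegral_dirac, lintegral_dirac, smul_eq_mul, smul_eq_mul, mul_add]

lemma step_of_stops {A : Matrix (Fin m) (Fin n) ℝ} {x₀ : E} {Δ : ℝ} {x : E}
    (h : Stops A x₀ Δ x) (g : E) (σ : ℝ) : step A x₀ Δ x g σ = x := if_pos h

lemma step_of_not_stops {A : Matrix (Fin m) (Fin n) ℝ} {x₀ : E} {Δ : ℝ} {x : E}
    (h : ¬ Stops A x₀ Δ x) (g : E) (σ : ℝ) : step A x₀ Δ x g σ =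
      x + (σ * stepLength A x₀ Δ x (direction (directions A x₀ Δ x) g)) •
        direction (directions A x₀ Δ x) g := if_neg h

lemma step_one_mem_polytope {A : Matrix (Fin m) (Fin n) ℝ} {x₀ : E} {Δ : ℝ} {x : E}
    (hx : x ∈ polytope A x₀ Δ) (g : E) : step A x₀ Δ x g 1 ∈ polytope A x₀ Δ := by
  by_cases h : Stops A x₀ Δ x
  · rwa [step_of_stops h]
  · rw [step_of_not_stops h, one_mul]
    exact (stepLength_mem_stepSet hx _).2.1

lemma step_neg_one_mem_polytope {A : Matrix (Fin m) (Fin n) ℝ} {x₀ : E} {Δ : ℝ} {x : E}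
    (hx : x ∈ polytope A x₀ Δ) (g : E) : step A x₀ Δ x g (-1) ∈ polytope A x₀ Δ := by
  by_cases h : Stops A x₀ Δ x
  · rwa [step_of_stops h]
  · rw [step_of_not_stops h, neg_one_mul, neg_smul, ← sub_eq_add_neg]
    exact (stepLength_mem_stepSet hx _).2.2

lemma mem_polytope_self {A : Matrix (Fin m) (Fin n) ℝ} {x₀ : E} {Δ : ℝ} (hΔ : 0 ≤ Δ)
    (hx₀ : ∀ j, |x₀ j| ≤ 1) : x₀ ∈ polytope A x₀ Δ :=
  ⟨hx₀, fun i => by simpa [apply_eq_inner] using hΔ⟩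

lemma ae_mem_polytope {A : Matrix (Fin m) (Fin n) ℝ} {x₀ : E} {Δ : ℝ}
    (h₀ : x₀ ∈ polytope A x₀ Δ) (t : ℕ) : ∀ᵐ x ∂(walkLaw A x₀ Δ t), x ∈ polytope A x₀ Δ := by
  have hK := (isClosed_polytope A x₀ Δ).measurableSet
  induction t with
  | zero => exact (ae_dirac_iff hK).2 h₀
  | succ t ih =>
    rw [ae_iff]
    change walkLaw A x₀ Δ (t + 1) (polytope A x₀ Δ)ᶜ = 0
    rw [← lintegral_indicator_one hK.compl,
      lintegral_walkLaw_succ _ _ _ _ (measurable_one.indicator hK.compl)]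
    rw [← nonpos_iff_eq_zero, ← lintegral_zero]
    refine lintegral_mono_ae ?_
    filter_upwards [ih] with x hx
    simp [step_one_mem_polytope hx, step_neg_one_mem_polytope hx]

/-! ### Subgaussian tails -/

/-- Averaging over the sign gives `cosh (l * ⟪a, u⟫)`, which increases with the step length `l ≤ 1`.
Hence `l` may be replaced by `1` even though it depends on `u`. Since `8 dim V > n`, the exponent
`‖a‖² / (2 dim V)` is at most `4 ‖a‖² / n`. -/
lemma lintegral_exp_step_le {A : Matrix (Fin m) (Fin n) ℝ} {x₀ : E} {Δ : ℝ} (hn : 1 ≤ n)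
    (a x : E) :
    ∫⁻ g, 2⁻¹ * (ENNReal.ofReal (Real.exp ⟪a, step A x₀ Δ x g 1 - x₀⟫) +
        ENNReal.ofReal (Real.exp ⟪a, step A x₀ Δ x g (-1) - x₀⟫)) ∂(stdGaussian E) ≤
      ENNReal.ofReal (Real.exp (4 * ‖a‖ ^ 2 / n)) * ENNReal.ofReal (Real.exp ⟪a, x - x₀⟫) := by
  have hhalf : (2⁻¹ : ℝ≥0∞) = ENNReal.ofReal 2⁻¹ := by
    rw [ENNReal.ofReal_inv_of_pos two_pos]; simp
  have hn' : (0 : ℝ) < n := by exact_mod_cast hn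
  by_cases h : Stops A x₀ Δ x
  · simp only [step_of_stops h]
    rw [lintegral_const, measure_univ, mul_one, ← two_mul, ← mul_assoc,
      ENNReal.inv_mul_cancel (by simp) (by simp)]
    gcongr
    rw [ENNReal.one_le_ofReal]
    exact Real.one_le_exp (by positivity)
  set V := directions A x₀ Δ x
  have hd : (n : ℝ) < 8 * finrank ℝ V := by
    have : n < 8 * finrank ℝ V := not_le.1 fun h' => h (Or.inr h')
    exact_mod_cast this
  have hpt : ∀ g, 2⁻¹ * (ENNReal.ofReal (Real.exp ⟪a, step A x₀ Δ x g 1 - x₀⟫) +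
        ENNReal.ofReal (Real.exp ⟪a, step A x₀ Δ x g (-1) - x₀⟫)) ≤
      ENNReal.ofReal (Real.exp ⟪a, x - x₀⟫) * (2⁻¹ *
        (ENNReal.ofReal (Real.exp ⟪a, direction V g⟫) +
          ENNReal.ofReal (Real.exp ⟪-a, direction V g⟫))) := by
    intro g
    rw [step_of_not_stops h, step_of_not_stops h]
    set u := direction V g
    set l := stepLength A x₀ Δ x u
    have hl0 : 0 ≤ l := stepLength_nonneg A x₀ Δ x u
    have hl1 : l ≤ 1 := stepLength_le_one A x₀ Δ x u
    rw [hhalf, ← ENNReal.ofReal_add (by positivity) (by positivity),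
      ← ENNReal.ofReal_add (by positivity) (by positivity), ← ENNReal.ofReal_mul (by positivity),
      ← ENNReal.ofReal_mul (by positivity), ← ENNReal.ofReal_mul (by positivity)]
    apply ENNReal.ofReal_le_ofReal
    have e : ∀ c : ℝ, ⟪a, x + c • u - x₀⟫ = ⟪a, x - x₀⟫ + c * ⟪a, u⟫ := by
      intro c
      rw [add_sub_right_comm, inner_add_right, inner_smul_right]
    rw [e, e, Real.exp_add, Real.exp_add, inner_neg_left]
    have hcosh : Real.cosh (l * ⟪a, u⟫) ≤ Real.cosh ⟪a, u⟫ := by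
      rw [Real.cosh_le_cosh, abs_mul, abs_of_nonneg hl0]
      exact mul_le_of_le_one_left (abs_nonneg _) hl1
    rw [Real.cosh_eq, Real.cosh_eq] at hcosh
    rw [one_mul, neg_one_mul, neg_mul]
    have := mul_le_mul_of_nonneg_left hcosh (Real.exp_pos ⟪a, x - x₀⟫).le
    linarith
  refine (lintegral_mono hpt).trans ?_
  have hm : ∀ b : E, Measurable fun g => ENNReal.ofReal (Real.exp ⟪b, direction V g⟫) := fun b =>
    (measurable_const.inner (measurable_direction V)).exp.ennreal_ofReal
  have hb : ∀ b : E, ‖b‖ = ‖a‖ →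
      ∫⁻ g, ENNReal.ofReal (Real.exp ⟪b, direction V g⟫) ∂(stdGaussian E) ≤
        ENNReal.ofReal (Real.exp (4 * ‖a‖ ^ 2 / n)) := by
    intro b hb
    refine (lintegral_exp_inner_direction_le V b).trans
      (ENNReal.ofReal_le_ofReal (Real.exp_le_exp.2 ?_))
    rw [hb, div_le_div_iff₀ (by linarith) hn']
    nlinarith [sq_nonneg ‖a‖]
  have hm2 := (hm a).add (hm (-a))
  simp only [Pi.add_def] at hm2
  rw [lintegral_const_mul _ (hm2.const_mul _), lintegral_const_mul _ hm2,
    lintegral_add_left (hm a), mul_comm]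
  gcongr
  calc 2⁻¹ * (∫⁻ g, ENNReal.ofReal (Real.exp ⟪a, direction V g⟫) ∂(stdGaussian E) +
        ∫⁻ g, ENNReal.ofReal (Real.exp ⟪-a, direction V g⟫) ∂(stdGaussian E))
      ≤ 2⁻¹ * (ENNReal.ofReal (Real.exp (4 * ‖a‖ ^ 2 / n)) +
        ENNReal.ofReal (Real.exp (4 * ‖a‖ ^ 2 / n))) := by
        gcongr
        · exact hb a rfl
        · exact hb (-a) (norm_neg a)
    _ = _ := by
        rw [← two_mul, ← mul_assoc, ENNReal.inv_mul_cancel (by simp) (by simp), one_mul]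

lemma lintegral_exp_walkLaw_le {A : Matrix (Fin m) (Fin n) ℝ} {x₀ : E} {Δ : ℝ} (hn : 1 ≤ n)
    (a : E) (t : ℕ) :
    ∫⁻ x, ENNReal.ofReal (Real.exp ⟪a, x - x₀⟫) ∂(walkLaw A x₀ Δ t) ≤
      ENNReal.ofReal (Real.exp (t * (4 * ‖a‖ ^ 2 / n))) := by
  have hm : Measurable fun x : E => ENNReal.ofReal (Real.exp ⟪a, x - x₀⟫) := by fun_prop
  induction t with
  | zero => simp [walkLaw, lintegral_dirac' _ hm]
  | succ t ih =>
    rw [lintegral_walkLaw_succ _ _ _ _ hm]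
    refine (lintegral_mono fun x => lintegral_exp_step_le hn a x).trans ?_
    rw [lintegral_const_mul _ hm]
    refine (mul_le_mul_right ih _).trans_eq ?_
    rw [← ENNReal.ofReal_mul (by positivity), ← Real.exp_add]
    push_cast
    ring_nf

lemma lintegral_exp_abs_walkLaw_le {A : Matrix (Fin m) (Fin n) ℝ} {x₀ : E} {Δ : ℝ} (hn : 1 ≤ n)
    (a : E) :
    ∫⁻ x, ENNReal.ofReal (Real.exp |⟪a, x - x₀⟫|) ∂(walkLaw A x₀ Δ (8 * n)) ≤
      ENNReal.ofReal (2 * Real.exp (32 * ‖a‖ ^ 2)) := by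
  have hn' : (n : ℝ) ≠ 0 := by positivity
  have hb : ∀ b : E, ‖b‖ = ‖a‖ →
      ∫⁻ x, ENNReal.ofReal (Real.exp ⟪b, x - x₀⟫) ∂(walkLaw A x₀ Δ (8 * n)) ≤
        ENNReal.ofReal (Real.exp (32 * ‖a‖ ^ 2)) := by
    intro b hb
    refine (lintegral_exp_walkLaw_le hn b (8 * n)).trans_eq ?_
    rw [hb]
    congr 2
    push_cast
    field_simp
    ring
  calc _ ≤ ∫⁻ x, (ENNReal.ofReal (Real.exp ⟪a, x - x₀⟫) +
        ENNReal.ofReal (Real.exp ⟪-a, x - x₀⟫)) ∂(walkLaw A x₀ Δ (8 * n)) := by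
        refine lintegral_mono fun x => ?_
        rw [← ENNReal.ofReal_add (by positivity) (by positivity), inner_neg_left]
        exact ENNReal.ofReal_le_ofReal (Real.exp_abs_le _)
    _ ≤ ENNReal.ofReal (Real.exp (32 * ‖a‖ ^ 2)) + ENNReal.ofReal (Real.exp (32 * ‖a‖ ^ 2)) := by
        rw [lintegral_add_left (by fun_prop)]
        exact add_le_add (hb a rfl) (hb (-a) (norm_neg a))
    _ = _ := by rw [← ENNReal.ofReal_add (by positivity) (by positivity), two_mul]

lemma walkLaw_tail_le {A : Matrix (Fin m) (Fin n) ℝ} {x₀ : E} {Δ : ℝ} (hn : 1 ≤ n)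
    {a : E} (ha : a ≠ 0) {s : ℝ} (hs : 0 ≤ s) :
    walkLaw A x₀ Δ (8 * n) {x | s ≤ |⟪a, x - x₀⟫|} ≤
      ENNReal.ofReal (2 * Real.exp (-(1 / 128) * (s ^ 2 / ‖a‖ ^ 2))) := by
  have hpos : 0 < ‖a‖ := norm_pos_iff.2 ha
  -- The minimiser of `32 l² ‖a‖² - l s`, with minimum `-s² / (128 ‖a‖²)`.
  set l : ℝ := s / (64 * ‖a‖ ^ 2) with hl
  have hl0 : 0 ≤ l := by positivity
  have hm : Measurable fun x : E => ENNReal.ofReal (Real.exp |⟪l • a, x - x₀⟫|) := by fun_prop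
  have h1 := mul_meas_ge_le_lintegral (μ := walkLaw A x₀ Δ (8 * n)) hm
    (ENNReal.ofReal (Real.exp (l * s)))
  have h2 : {x : E | s ≤ |⟪a, x - x₀⟫|} ⊆ {x : E | ENNReal.ofReal (Real.exp (l * s)) ≤
      ENNReal.ofReal (Real.exp |⟪l • a, x - x₀⟫|)} := by
    intro x hx
    refine ENNReal.ofReal_le_ofReal (Real.exp_le_exp.2 ?_)
    rw [real_inner_smul_left, abs_mul, abs_of_nonneg hl0]
    exact mul_le_mul_of_nonneg_left hx hl0
  have h3 := ((mul_le_mul_right (measure_mono h2) _).trans h1).trans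
    (lintegral_exp_abs_walkLaw_le hn (l • a))
  have h4 : ENNReal.ofReal (2 * Real.exp (32 * ‖l • a‖ ^ 2)) = ENNReal.ofReal (Real.exp (l * s)) *
      ENNReal.ofReal (2 * Real.exp (-(1 / 128) * (s ^ 2 / ‖a‖ ^ 2))) := by
    rw [← ENNReal.ofReal_mul (by positivity), mul_left_comm, ← Real.exp_add]
    congr 3
    rw [norm_smul, Real.norm_eq_abs, abs_of_nonneg hl0, hl]
    field_simp
    ring
  rw [h4] at h3
  exact (ENNReal.mul_le_mul_iff_right (by simpa using Real.exp_pos _) (by simp)).1 h3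

lemma lintegral_abs_rpow_walkLaw_le {A : Matrix (Fin m) (Fin n) ℝ} {x₀ : E} {Δ : ℝ} (hn : 1 ≤ n)
    (a : E) {p : ℝ} (hp : 1 ≤ p) :
    ∫⁻ x, ENNReal.ofReal (|⟪a, x - x₀⟫| ^ p) ∂(walkLaw A x₀ Δ (8 * n)) ≤
      ENNReal.ofReal ((2 * Real.exp 32 * √p * ‖a‖) ^ p) := by
  have hp0 : 0 < p := by linarith
  by_cases ha : a = 0
  · simp [ha, Real.zero_rpow hp0.ne']
  have hpos : 0 < ‖a‖ := norm_pos_iff.2 ha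
  -- This makes `32 ‖l • a‖² = 32 p`, so the exponential moment is at most `2 exp (32 p) ≤ (2 exp
  -- 32)^p`. The power is bounded by the exponential through `z ≤ exp z` at `z = l * y / p`.
  set l : ℝ := √p / ‖a‖ with hl
  have hlpos : 0 < l := by positivity
  have hpt : ∀ x : E, ENNReal.ofReal (|⟪a, x - x₀⟫| ^ p) ≤
      ENNReal.ofReal ((√p * ‖a‖) ^ p) * ENNReal.ofReal (Real.exp |⟪l • a, x - x₀⟫|) := by
    intro x
    rw [← ENNReal.ofReal_mul (by positivity)]
    apply ENNReal.ofReal_le_ofReal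
    rw [real_inner_smul_left, abs_mul, abs_of_pos hlpos]
    set y := |⟪a, x - x₀⟫|
    have hy : 0 ≤ y := abs_nonneg _
    have h1 : l * y / p ≤ Real.exp (l * y / p) := by
      linarith [Real.add_one_le_exp (l * y / p)]
    have h2 : y = √p * ‖a‖ * (l * y / p) := by
      rw [hl]
      field_simp
      rw [Real.sq_sqrt hp0.le]
    calc y ^ p = (√p * ‖a‖) ^ p * (l * y / p) ^ p := by
          rw [← Real.mul_rpow (by positivity) (by positivity), ← h2]
      _ ≤ (√p * ‖a‖) ^ p * (Real.exp (l * y / p)) ^ p := by gcongr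
      _ = (√p * ‖a‖) ^ p * Real.exp (l * y) := by
          rw [← Real.exp_mul, div_mul_cancel₀ _ hp0.ne']
  refine (lintegral_mono hpt).trans ?_
  rw [lintegral_const_mul _ (by fun_prop)]
  refine (mul_le_mul_right (lintegral_exp_abs_walkLaw_le hn (l • a)) _).trans ?_
  rw [← ENNReal.ofReal_mul (by positivity)]
  apply ENNReal.ofReal_le_ofReal
  have e1 : ‖l • a‖ ^ 2 = p := by
    rw [norm_smul, Real.norm_eq_abs, abs_of_pos hlpos, hl, div_mul_cancel₀ _ hpos.ne',
      Real.sq_sqrt hp0.le]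
  rw [e1, mul_assoc (2 * Real.exp 32), Real.mul_rpow (x := 2 * Real.exp 32) (by positivity)
    (by positivity), Real.mul_rpow zero_le_two (by positivity), ← Real.exp_mul, mul_comm]
  gcongr
  exact Real.self_le_rpow_of_one_le one_le_two hp

/-! ### The walk stops in time -/

/-- The potential that drops in expectation while the walk has not stopped. -/
def potential (A : Matrix (Fin m) (Fin n) ℝ) (x₀ : E) (Δ : ℝ) (x : E) : ℝ :=
  n - ‖x‖ ^ 2 + 2 * finrank ℝ (tightSpace A (tightPattern A x₀ Δ x))

lemma measurable_potential (A : Matrix (Fin m) (Fin n) ℝ) (x₀ : E) (Δ : ℝ) :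
    Measurable (potential A x₀ Δ) := by
  have h : Measurable fun x : E => (finrank ℝ (tightSpace A (tightPattern A x₀ Δ x)) : ℝ) :=
    (measurable_of_countable fun T => (finrank ℝ (tightSpace A T) : ℝ)).comp
        (measurable_tightPattern A x₀ Δ)
  unfold potential
  fun_prop

lemma potential_nonneg {A : Matrix (Fin m) (Fin n) ℝ} {x₀ : E} {Δ : ℝ} {x : E}
    (hx : x ∈ polytope A x₀ Δ) : 0 ≤ potential A x₀ Δ x := by
  have := norm_sq_le_of_mem_polytope hx
  unfold potential
  have h2 : (0 : ℝ) ≤ finrank ℝ (tightSpace A (tightPattern A x₀ Δ x)) := Nat.cast_nonneg _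
  linarith

lemma potential_le (A : Matrix (Fin m) (Fin n) ℝ) (x₀ : E) (Δ : ℝ) (x : E) :
    potential A x₀ Δ x ≤ 3 * n := by
  have h1 : finrank ℝ (tightSpace A (tightPattern A x₀ Δ x)) ≤ n := by
    simpa using (tightSpace A (tightPattern A x₀ Δ x)).finrank_le
  have h2 : (finrank ℝ (tightSpace A (tightPattern A x₀ Δ x)) : ℝ) ≤ n := by exact_mod_cast h1
  unfold potential
  nlinarith [sq_nonneg ‖x‖]

/-- Averaged over the sign, a full step increases `‖x‖²` by `1` by the parallelogram law. A shorter
step makes a new condition tight at one of the two end points, so the dimension drops there; the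
weight `2` in `potential` makes the averaged drop at least `1` again. -/
lemma potential_add_potential_le {A : Matrix (Fin m) (Fin n) ℝ} {x₀ : E} {Δ : ℝ} {x u : E}
    (hx : x ∈ polytope A x₀ Δ) (hu : u ∈ tightSpace A (tightPattern A x₀ Δ x)) (hu1 : ‖u‖ = 1) :
    potential A x₀ Δ (x + stepLength A x₀ Δ x u • u) +
      potential A x₀ Δ (x + (-stepLength A x₀ Δ x u) • u) + 2 ≤ 2 * potential A x₀ Δ x := by
  set r := stepLength A x₀ Δ x u with hr
  have hu0 : u ≠ 0 := by rintro rfl; simp at hu1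
  have hnorm : ‖x + r • u‖ ^ 2 + ‖x + (-r) • u‖ ^ 2 = 2 * ‖x‖ ^ 2 + 2 * r ^ 2 := by
    have := parallelogram_law_with_norm ℝ x (r • u)
    rw [norm_smul, hu1, mul_one, Real.norm_eq_abs] at this
    rw [neg_smul, ← sub_eq_add_neg]
    nlinarith [sq_abs r]
  have hle : ∀ c : ℝ, tightSpace A (tightPattern A x₀ Δ (x + c • u)) ≤
      tightSpace A (tightPattern A x₀ Δ x) := fun c => tightSpace_anti (tightPattern_le hu c)
  have hfle : ∀ c : ℝ, (finrank ℝ (tightSpace A (tightPattern A x₀ Δ (x + c • u))) : ℝ) ≤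
      finrank ℝ (tightSpace A (tightPattern A x₀ Δ x)) := fun c => by
    exact_mod_cast Submodule.finrank_mono (hle c)
  have hflt : ∀ c : ℝ, u ∉ tightSpace A (tightPattern A x₀ Δ (x + c • u)) →
      (finrank ℝ (tightSpace A (tightPattern A x₀ Δ (x + c • u))) : ℝ) + 1 ≤
        finrank ℝ (tightSpace A (tightPattern A x₀ Δ x)) := fun c hc => by
    exact_mod_cast Submodule.finrank_lt_finrank_of_lt
      (lt_of_le_of_ne (hle c) fun h => hc (h ▸ hu))
  have h1 := hfle r
  have h2 := hfle (-r)
  unfold potential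
  rcases (stepLength_le_one A x₀ Δ x u).eq_or_lt with h | h
  · rw [← hr] at h
    rw [h] at hnorm h1 h2 ⊢
    linarith
  · rw [← hr] at h
    rcases notMem_tightSpace_of_stepLength_lt_one hx hu0 h with h' | h'
    · have := hflt _ h'
      rw [← hr] at this
      nlinarith [sq_nonneg r]
    · have := hflt _ h'
      rw [← hr] at this
      nlinarith [sq_nonneg r]

lemma lintegral_potential_step_le {A : Matrix (Fin m) (Fin n) ℝ} {x₀ : E} {Δ : ℝ} {x : E}
    (hx : x ∈ polytope A x₀ Δ) :
    ∫⁻ g, 2⁻¹ * (ENNReal.ofReal (potential A x₀ Δ (step A x₀ Δ x g 1)) +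
        ENNReal.ofReal (potential A x₀ Δ (step A x₀ Δ x g (-1)))) ∂(stdGaussian E) +
      {x | Stops A x₀ Δ x}ᶜ.indicator 1 x ≤ ENNReal.ofReal (potential A x₀ Δ x) := by
  have hhalf : (2⁻¹ : ℝ≥0∞) = ENNReal.ofReal 2⁻¹ := by
    rw [ENNReal.ofReal_inv_of_pos two_pos]; simp
  by_cases h : Stops A x₀ Δ x
  · simp only [step_of_stops h]
    rw [lintegral_const, measure_univ, mul_one, ← two_mul, ← mul_assoc,
      ENNReal.inv_mul_cancel (by simp) (by simp)]
    simp [h]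
  have hV : directions A x₀ Δ x ≠ ⊥ := fun h' => h (Or.inr (by rw [h', finrank_bot]; simp))
  have hφ := potential_nonneg hx
  have key : ∀ᵐ g ∂(stdGaussian E),
      2⁻¹ * (ENNReal.ofReal (potential A x₀ Δ (step A x₀ Δ x g 1)) +
        ENNReal.ofReal (potential A x₀ Δ (step A x₀ Δ x g (-1)))) ≤
      ENNReal.ofReal (potential A x₀ Δ x - 1) ∧ 1 ≤ potential A x₀ Δ x := by
    filter_upwards [ae_starProjection_ne_zero hV] with g hg
    have hp := potential_nonneg (step_one_mem_polytope hx g)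
    have hq := potential_nonneg (step_neg_one_mem_polytope hx g)
    have hle := potential_add_potential_le hx
      (directions_le A x₀ Δ x (direction_mem (directions A x₀ Δ x) g)) (norm_direction hg)
    rw [step_of_not_stops h, one_mul] at hp
    rw [step_of_not_stops h, neg_one_mul] at hq
    rw [step_of_not_stops h, step_of_not_stops h, one_mul, neg_one_mul, hhalf,
      ← ENNReal.ofReal_add hp hq, ← ENNReal.ofReal_mul (by norm_num)]
    exact ⟨ENNReal.ofReal_le_ofReal (by linarith), by linarith⟩
  -- The bound `1 ≤ potential` does not involve `g`, so one good `g` suffices. It prevents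
  -- `ENNReal.ofReal` from truncating `potential - 1`.
  obtain ⟨-, -, h1⟩ := key.exists
  rw [Set.indicator_of_mem (by simpa using h), Pi.one_apply]
  calc _ ≤ ∫⁻ _g, ENNReal.ofReal (potential A x₀ Δ x - 1) ∂(stdGaussian E) + 1 := by
        gcongr ?_ + 1
        exact lintegral_mono_ae (key.mono fun g hg => hg.1)
    _ = ENNReal.ofReal (potential A x₀ Δ x - 1) + ENNReal.ofReal 1 := by simp
    _ = _ := by rw [← ENNReal.ofReal_add (by linarith) zero_le_one, sub_add_cancel]

lemma walkLaw_not_stops_succ_le (A : Matrix (Fin m) (Fin n) ℝ) (x₀ : E) (Δ : ℝ) (t : ℕ) :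
    walkLaw A x₀ Δ (t + 1) {x | Stops A x₀ Δ x}ᶜ ≤ walkLaw A x₀ Δ t {x | Stops A x₀ Δ x}ᶜ := by
  have hS := (measurableSet_stops A x₀ Δ).compl
  rw [← lintegral_indicator_one hS, ← lintegral_indicator_one hS,
    lintegral_walkLaw_succ _ _ _ _ (measurable_one.indicator hS)]
  refine lintegral_mono fun x => ?_
  by_cases h : Stops A x₀ Δ x
  · simp [step_of_stops h, h]
  · rw [Set.indicator_of_mem (by simpa using h)]
    calc _ ≤ ∫⁻ _g, 1 ∂(stdGaussian E) := by
          refine lintegral_mono fun g => ?_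
          calc _ ≤ 2⁻¹ * ((1 : ℝ≥0∞) + 1) := by
                gcongr <;> exact Set.indicator_le_self' (fun _ _ => zero_le) _
            _ = 1 := by
                rw [one_add_one_eq_two, ENNReal.inv_mul_cancel (by simp) (by simp)]
      _ = _ := by simp

/-- The expected drops of `potential` add up to at most its initial value. The probability of not
having stopped is nonincreasing in time, so each of the `t` drops is at least its value at time `t`.
-/
lemma walkLaw_not_stops_le {A : Matrix (Fin m) (Fin n) ℝ} {x₀ : E} {Δ : ℝ}
    (h₀ : x₀ ∈ polytope A x₀ Δ) (t : ℕ) :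
    t * walkLaw A x₀ Δ t {x | Stops A x₀ Δ x}ᶜ ≤ 3 * n := by
  have hS := (measurableSet_stops A x₀ Δ).compl
  have hm : Measurable fun x => ENNReal.ofReal (potential A x₀ Δ x) :=
    (measurable_potential A x₀ Δ).ennreal_ofReal
  have key : ∫⁻ x, ENNReal.ofReal (potential A x₀ Δ x) ∂(walkLaw A x₀ Δ t) +
      t * walkLaw A x₀ Δ t {x | Stops A x₀ Δ x}ᶜ ≤ 3 * n := by
    induction t with
    | zero =>
      simp only [walkLaw, lintegral_dirac' _ hm, Nat.cast_zero, zero_mul, add_zero]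
      refine (ENNReal.ofReal_le_ofReal (potential_le A x₀ Δ x₀)).trans_eq ?_
      rw [ENNReal.ofReal_mul (by norm_num)]
      simp
    | succ t ih =>
      refine le_trans ?_ ih
      have h1 : ∫⁻ x, ENNReal.ofReal (potential A x₀ Δ x) ∂(walkLaw A x₀ Δ (t + 1)) +
          walkLaw A x₀ Δ t {x | Stops A x₀ Δ x}ᶜ ≤
          ∫⁻ x, ENNReal.ofReal (potential A x₀ Δ x) ∂(walkLaw A x₀ Δ t) := by
        rw [lintegral_walkLaw_succ _ _ _ _ hm, ← lintegral_indicator_one hS,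
          ← lintegral_add_right _ (measurable_one.indicator hS)]
        refine lintegral_mono_ae ?_
        filter_upwards [ae_mem_polytope h₀ t] with x hx
        exact lintegral_potential_step_le hx
      have h2 := walkLaw_not_stops_succ_le A x₀ Δ t
      calc _ ≤ ∫⁻ x, ENNReal.ofReal (potential A x₀ Δ x) ∂(walkLaw A x₀ Δ (t + 1)) +
            ((t + 1 : ℕ) : ℝ≥0∞) * walkLaw A x₀ Δ t {x | Stops A x₀ Δ x}ᶜ := by gcongr
        _ = (∫⁻ x, ENNReal.ofReal (potential A x₀ Δ x) ∂(walkLaw A x₀ Δ (t + 1)) +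
            walkLaw A x₀ Δ t {x | Stops A x₀ Δ x}ᶜ) +
              t * walkLaw A x₀ Δ t {x | Stops A x₀ Δ x}ᶜ := by push_cast; ring
        _ ≤ _ := by gcongr
  exact le_add_self.trans key

/-! ### The walk succeeds -/

/-- A tight constraint is the tail event at `s = Δ`. The condition `C₁ ≤ 1 / 128` makes each tail
bound at most twice the corresponding term of `rowSum`. -/
lemma sum_walkLaw_tight_le {A : Matrix (Fin m) (Fin n) ℝ} {x₀ : E} {Δ C₁ : ℝ} (hn : 1 ≤ n)
    (hΔ : 0 ≤ Δ) (hC : C₁ ≤ 1 / 128) :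
    ∑ i, walkLaw A x₀ Δ (8 * n) {x | A i ≠ 0 ∧ |apply A (x - x₀) i| = Δ} ≤
      ENNReal.ofReal (2 * rowSum C₁ A Δ) := by
  classical
  rw [rowSum, Finset.mul_sum, ENNReal.ofReal_sum_of_nonneg
    (fun i _ => by split_ifs <;> positivity)]
  refine Finset.sum_le_sum fun i _ => ?_
  by_cases h : A i = 0
  · simp [h]
  · rw [if_neg h]
    have h' : row A i ≠ 0 := fun h0 => h (row_eq_zero_iff.1 h0)
    refine (measure_mono fun x hx => ?_).trans
      ((walkLaw_tail_le (a := row A i) hn h' hΔ).trans (ENNReal.ofReal_le_ofReal ?_))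
    · change Δ ≤ |⟪row A i, x - x₀⟫|
      rw [← apply_eq_inner]
      exact hx.2.ge
    · rw [norm_row_sq]
      gcongr

/-- Markov's inequality: the expected number of tight nonzero rows is at most `2 * C₂ * n ≤ n / 64`,
against a threshold of `n / 8`. -/
lemma walkLaw_many_tight_le {A : Matrix (Fin m) (Fin n) ℝ} {x₀ : E} {Δ C₁ C₂ : ℝ} (hn : 1 ≤ n)
    (hΔ : 0 ≤ Δ) (hC : C₁ ≤ 1 / 128) (hC₂ : C₂ ≤ 1 / 128) (hrow : rowSum C₁ A Δ ≤ C₂ * n) :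
    walkLaw A x₀ Δ (8 * n)
      {x | n ≤ 8 * Nat.card {i // A i ≠ 0 ∧ |apply A (x - x₀) i| = Δ}} ≤ 8⁻¹ := by
  classical
  set S : Fin m → Set E := fun i => {x | A i ≠ 0 ∧ |apply A (x - x₀) i| = Δ} with hS
  have hSm : ∀ i, MeasurableSet (S i) := fun i =>
    (MeasurableSet.const _).inter
      (measurableSet_eq_fun (measurable_apply A x₀ i).abs measurable_const)
  have hcard : ∀ x, (Nat.card {i // A i ≠ 0 ∧ |apply A (x - x₀) i| = Δ} : ℝ≥0∞) =
      ∑ i, (S i).indicator 1 x := by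
    intro x
    rw [Nat.card_eq_fintype_card, Fintype.card_subtype, Finset.card_filter]
    push_cast
    refine Finset.sum_congr rfl fun i _ => ?_
    simp [Set.indicator_apply, hS]
  have hm : Measurable fun x => 8 * ∑ i, (S i).indicator (1 : E → ℝ≥0∞) x :=
    (Finset.measurable_fun_sum _ fun i _ => measurable_one.indicator (hSm i)).const_mul _
  have h1 := mul_meas_ge_le_lintegral (μ := walkLaw A x₀ Δ (8 * n)) hm (n : ℝ≥0∞)
  have h2 : {x | n ≤ 8 * Nat.card {i // A i ≠ 0 ∧ |apply A (x - x₀) i| = Δ}} ⊆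
      {x | (n : ℝ≥0∞) ≤ 8 * ∑ i, (S i).indicator (1 : E → ℝ≥0∞) x} := by
    intro x hx
    change (n : ℝ≥0∞) ≤ _
    rw [← hcard]
    exact_mod_cast hx
  rw [lintegral_const_mul _ (Finset.measurable_fun_sum _ fun i _ => measurable_one.indicator (hSm i)),
    lintegral_finsetSum _ (fun i _ => measurable_one.indicator (hSm i))] at h1
  simp only [lintegral_indicator_one (hSm _)] at h1
  have h3 : (n : ℝ≥0∞) * walkLaw A x₀ Δ (8 * n)
      {x | n ≤ 8 * Nat.card {i // A i ≠ 0 ∧ |apply A (x - x₀) i| = Δ}} ≤ n * 8⁻¹ := by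
    calc _ ≤ 8 * ∑ i, walkLaw A x₀ Δ (8 * n) (S i) := (mul_le_mul_right (measure_mono h2) _).trans h1
      _ ≤ 8 * ENNReal.ofReal (2 * rowSum C₁ A Δ) := by
          gcongr
          exact sum_walkLaw_tight_le hn hΔ hC
      _ ≤ ENNReal.ofReal 8 * ENNReal.ofReal (2 * (1 / 128 * n)) := by
          rw [show (8 : ℝ≥0∞) = ENNReal.ofReal 8 by simp]
          gcongr
          exact hrow.trans (by gcongr)
      _ = ENNReal.ofReal (n * 8⁻¹) := by
          rw [← ENNReal.ofReal_mul (by norm_num)]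
          congr 1
          ring
      _ = n * 8⁻¹ := by
          rw [ENNReal.ofReal_mul (by positivity), ENNReal.ofReal_inv_of_pos (by norm_num)]
          simp
  exact (ENNReal.mul_le_mul_iff_right (by simpa using (by omega : n ≠ 0)) (by simp)).1 h3

/-- The walk produces a partial coloring with probability at least `1 / 2`. -/
lemma walkLaw_isPartialColoring_ge {A : Matrix (Fin m) (Fin n) ℝ} {x₀ : E} {Δ C₁ C₂ : ℝ}
    (hn : 1 ≤ n) (hΔ : 0 ≤ Δ) (hx₀ : ∀ j, |x₀ j| ≤ 1) (hC : C₁ ≤ 1 / 128) (hC₂ : C₂ ≤ 1 / 128)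
    (hrow : rowSum C₁ A Δ ≤ C₂ * n) :
    2⁻¹ ≤ walkLaw A x₀ Δ (8 * n) {x | IsPartialColoring x} := by
  have h1 := walkLaw_not_stops_le (mem_polytope_self (A := A) hΔ hx₀) (8 * n)
  have h2 := walkLaw_many_tight_le (x₀ := x₀) hn hΔ hC hC₂ hrow
  set μ := walkLaw A x₀ Δ (8 * n)
  set N : Set E := {x | Stops A x₀ Δ x}ᶜ
  set T : Set E := {x | n ≤ 8 * Nat.card {i // A i ≠ 0 ∧ |apply A (x - x₀) i| = Δ}}
  set P : Set E := {x | IsPartialColoring x}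
  -- Failure means either still running (probability at most `3n / 8n`) or stopped with many tight
  -- rows (at most `1 / 8`), which leaves `1 / 2`.
  have hcover : (Set.univ : Set E) ⊆ P ∪ (N ∪ T) := by
    intro x _
    by_cases hP : IsPartialColoring x
    · exact Or.inl hP
    · by_cases hs : Stops A x₀ Δ x
      · exact Or.inr (Or.inr (card_tight_ge_of_stops hn hs hP))
      · exact Or.inr (Or.inl hs)
  have h3 : 1 ≤ μ P + (μ N + μ T) := by
    rw [← measure_univ (μ := μ)]
    exact (measure_mono hcover).trans
      ((measure_union_le _ _).trans (add_le_add le_rfl (measure_union_le _ _)))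
  rw [← ENNReal.ofReal_toReal (measure_ne_top μ P)] at h3 ⊢
  rw [← ENNReal.ofReal_toReal (measure_ne_top μ N)] at h1 h3
  rw [← ENNReal.ofReal_toReal (measure_ne_top μ T)] at h2 h3
  set a := (μ P).toReal
  set b := (μ N).toReal
  set c := (μ T).toReal
  have ha : 0 ≤ a := ENNReal.toReal_nonneg
  have hb : 0 ≤ b := ENNReal.toReal_nonneg
  have hc : 0 ≤ c := ENNReal.toReal_nonneg
  have hn' : (0 : ℝ) < n := by exact_mod_cast hn
  rw [← ENNReal.ofReal_add hb hc, ← ENNReal.ofReal_add ha (by positivity),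
    ENNReal.one_le_ofReal] at h3
  have h1' : ENNReal.ofReal ((8 * n : ℕ) * b) ≤ ENNReal.ofReal (3 * n) := by
    rw [ENNReal.ofReal_mul (by positivity), ENNReal.ofReal_natCast, ENNReal.ofReal_mul (by norm_num)]
    simpa using h1
  rw [ENNReal.ofReal_le_ofReal_iff (by positivity)] at h1'
  have hb' : b ≤ 3 / 8 := by
    push_cast at h1'
    rw [le_div_iff₀ (by norm_num)]
    exact le_of_mul_le_mul_left (by linarith) hn'
  have h2' : ENNReal.ofReal c ≤ ENNReal.ofReal 8⁻¹ := by
    rw [ENNReal.ofReal_inv_of_pos (by norm_num)]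
    simpa using h2
  rw [ENNReal.ofReal_le_ofReal_iff (by positivity)] at h2'
  calc (2⁻¹ : ℝ≥0∞) = ENNReal.ofReal 2⁻¹ := by rw [ENNReal.ofReal_inv_of_pos two_pos]; simp
    _ ≤ ENNReal.ofReal a := ENNReal.ofReal_le_ofReal (by linarith)

/-! ### The radius of the polytope -/

lemma continuous_rowSum (C₁ : ℝ) (A : Matrix (Fin m) (Fin n) ℝ) : Continuous (rowSum C₁ A) := by
  unfold rowSum
  refine continuous_finsetSum _ fun i _ => ?_
  split_ifs
  · exact continuous_const
  · fun_prop

lemma sum_sq_pos {A : Matrix (Fin m) (Fin n) ℝ} {i : Fin m} (h : A i ≠ 0) :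
    0 < ∑ j, A i j ^ 2 := by
  rw [← norm_row_sq]
  have : row A i ≠ 0 := fun h0 => h (row_eq_zero_iff.1 h0)
  positivity

lemma tendsto_rowSum {C₁ : ℝ} (hC : 0 < C₁) (A : Matrix (Fin m) (Fin n) ℝ) :
    Tendsto (rowSum C₁ A) atTop (𝓝 0) := by
  rw [← Finset.sum_const_zero (s := (Finset.univ : Finset (Fin m)))]
  unfold rowSum
  refine tendsto_finsetSum _ fun i _ => ?_
  split_ifs with h
  · exact tendsto_const_nhds
  · refine Real.tendsto_exp_atBot.comp ?_
    exact ((tendsto_pow_atTop two_ne_zero).atTop_div_const (sum_sq_pos h)).const_mul_atTop_of_neg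
      (by linarith)

lemma radius_mem {C₁ C₂ : ℝ} (hC₁ : 0 < C₁) (hC₂ : 0 < C₂) (hn : 1 ≤ n)
    (A : Matrix (Fin m) (Fin n) ℝ) :
    0 ≤ radius C₁ C₂ A ∧ rowSum C₁ A (radius C₁ C₂ A) ≤ C₂ * n := by
  have hn' : (0 : ℝ) < n := by exact_mod_cast hn
  have hclosed : IsClosed {Δ : ℝ | 0 ≤ Δ ∧ rowSum C₁ A Δ ≤ C₂ * n} :=
    (isClosed_le continuous_const continuous_id).inter
      (isClosed_le (continuous_rowSum C₁ A) continuous_const)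
  -- The infimum is attained, as the admissible set is closed, bounded below, and nonempty because
  -- `rowSum` tends to `0`.
  refine hclosed.csInf_mem ?_ ⟨0, fun _ h => h.1⟩
  obtain ⟨Δ, h1, h2⟩ := (((tendsto_rowSum hC₁ A).eventually_le_const
    (show 0 < C₂ * n by positivity)).and (eventually_ge_atTop 0)).exists
  exact ⟨Δ, h2, h1⟩

lemma radius_le {C₁ C₂ B : ℝ} {A : Matrix (Fin m) (Fin n) ℝ} (hB : 0 ≤ B)
    (h : rowSum C₁ A B ≤ C₂ * n) : radius C₁ C₂ A ≤ B :=
  csInf_le ⟨0, fun _ h => h.1⟩ ⟨hB, h⟩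

/-- Termwise this is `exp (-(p/2) z⁻²) ≤ z^p`, which follows from `log y ≤ y - 1` at `y = z⁻²`. It
bounds the radius by the same row sums that control the moments. -/
lemma rowSum_le_sum_rpow {C₁ B p : ℝ} (hC₁ : 0 < C₁) (hB : 0 < B) (hp : 0 < p)
    (A : Matrix (Fin m) (Fin n) ℝ) :
    rowSum C₁ A B ≤ ∑ i, (√(p / (2 * C₁)) * ‖row A i‖ / B) ^ p := by
  unfold rowSum
  refine Finset.sum_le_sum fun i _ => ?_
  split_ifs with h
  · positivity
  have h' : row A i ≠ 0 := fun h0 => h (row_eq_zero_iff.1 h0)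
  rw [← norm_row_sq]
  set a := ‖row A i‖ with ha
  have hapos : 0 < a := norm_pos_iff.2 h'
  set z := √(p / (2 * C₁)) * a / B with hz
  have hzpos : 0 < z := by positivity
  have hz2 : C₁ * (B ^ 2 / a ^ 2) = p / 2 * (z ^ 2)⁻¹ := by
    rw [hz, div_pow, mul_pow, Real.sq_sqrt (by positivity)]
    field_simp
  rw [neg_mul, hz2, Real.rpow_def_of_pos hzpos]
  apply Real.exp_le_exp.2
  have h1 := Real.log_le_sub_one_of_pos (show 0 < (z ^ 2)⁻¹ by positivity)
  rw [Real.log_inv, Real.log_pow] at h1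
  push_cast at h1
  nlinarith

/-- The power mean inequality within each row, followed by exchanging the sums so that the column
bounds apply. -/
lemma sum_norm_row_rpow_le {A : Matrix (Fin m) (Fin n) ℝ} {p M : ℝ} (hp : 2 ≤ p) (hn : 1 ≤ n)
    (hM : ∀ j, ∑ i, |A i j| ^ p ≤ M ^ p) :
    ∑ i, ‖row A i‖ ^ p ≤ (n : ℝ) ^ (p / 2) * M ^ p := by
  have hn' : (0 : ℝ) < n := by exact_mod_cast hn
  have hrow : ∀ i, ‖row A i‖ ^ p ≤ (n : ℝ) ^ (p / 2 - 1) * ∑ j, |A i j| ^ p := by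
    intro i
    have h1 := Real.rpow_sum_le_const_mul_sum_rpow (Finset.univ : Finset (Fin n))
      (fun j => A i j ^ 2) (show 1 ≤ p / 2 by linarith)
    simp only [abs_sq, Finset.card_univ, Fintype.card_fin] at h1
    rw [← norm_row_sq] at h1
    have e : ∀ x : ℝ, 0 ≤ x → (x ^ 2) ^ (p / 2) = x ^ p := by
      intro x hx
      rw [← Real.rpow_natCast, ← Real.rpow_mul hx]
      congr 1
      push_cast
      ring
    rw [e _ (norm_nonneg _)] at h1
    refine h1.trans_eq ?_
    congr 1
    refine Finset.sum_congr rfl fun j _ => ?_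
    rw [← sq_abs, e _ (abs_nonneg _)]
  calc ∑ i, ‖row A i‖ ^ p ≤ ∑ i, (n : ℝ) ^ (p / 2 - 1) * ∑ j, |A i j| ^ p :=
        Finset.sum_le_sum fun i _ => hrow i
    _ = (n : ℝ) ^ (p / 2 - 1) * ∑ j, ∑ i, |A i j| ^ p := by
        rw [← Finset.mul_sum, Finset.sum_comm]
    _ ≤ (n : ℝ) ^ (p / 2 - 1) * ∑ _j : Fin n, M ^ p := by
        gcongr with j
        exact hM j
    _ = (n : ℝ) ^ (p / 2) * M ^ p := by
        rw [Finset.sum_const, Finset.card_univ, Fintype.card_fin, nsmul_eq_mul, ← mul_assoc]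
        congr 1
        rw [← Real.rpow_add_one hn'.ne', sub_add_cancel]

/-- Rescaled row norms: the common estimate behind the bounds on the radius and on the moments. -/
lemma sum_norm_row_div_rpow_le {A : Matrix (Fin m) (Fin n) ℝ} {p M K c : ℝ} (hp : 2 ≤ p)
    (hn : 1 ≤ n) (hM0 : 0 < M) (hK : 0 < K) (hc : 0 ≤ c) (hM : ∀ j, ∑ i, |A i j| ^ p ≤ M ^ p) :
    ∑ i, (c * √p * ‖row A i‖ / (K * √p * M * (n : ℝ) ^ (1 / 2 - 1 / p))) ^ p ≤
      (c / K) ^ p * n := by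
  have hn' : (0 : ℝ) < n := by exact_mod_cast hn
  have hp0 : 0 < p := by linarith
  have hterm : ∀ i, (c * √p * ‖row A i‖ / (K * √p * M * (n : ℝ) ^ (1 / 2 - 1 / p))) ^ p =
      (c / K) ^ p / (M ^ p * (n : ℝ) ^ (p / 2 - 1)) * ‖row A i‖ ^ p := by
    intro i
    have e : c * √p * ‖row A i‖ / (K * √p * M * (n : ℝ) ^ (1 / 2 - 1 / p)) =
        (c / K) / (M * (n : ℝ) ^ (1 / 2 - 1 / p)) * ‖row A i‖ := by
      field_simp
    rw [e, Real.mul_rpow (by positivity) (by positivity), Real.div_rpow (by positivity)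
      (by positivity), Real.mul_rpow (by positivity) (by positivity), ← Real.rpow_mul hn'.le]
    congr 4
    field_simp
  simp only [hterm]
  rw [← Finset.mul_sum]
  calc _ ≤ (c / K) ^ p / (M ^ p * (n : ℝ) ^ (p / 2 - 1)) * ((n : ℝ) ^ (p / 2) * M ^ p) := by
        gcongr
        exact sum_norm_row_rpow_le hp hn hM
    _ = (c / K) ^ p * n := by
        rw [Real.rpow_sub_one hn'.ne']
        field_simp

/-! ### The expected norm for a fixed finite exponent -/

/-- Since `|v i| / B ≤ 1`, raising the exponent from `p` to `q` only decreases the sum `S` of the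
powers. Writing `S^(1/q) = n^(1/q) (S/n)^(1/q)` and using `z^(1/q) ≤ 1 + z` makes the bound linear
in `S`, ready for taking expectations. -/
lemma lqNorm_le {v : Fin m → ℝ} {B p : ℝ} {q : ℝ≥0∞} (hn : 1 ≤ n) (hB : 0 < B) (hp : 2 ≤ p)
    (hpq : ENNReal.ofReal p ≤ q) (hv : ∀ i, |v i| ≤ B) :
    lqNorm q v ≤ B * (n : ℝ) ^ (q⁻¹).toReal * (1 + (∑ i, (|v i| / B) ^ p) / n) := by
  have hn' : (0 : ℝ) < n := by exact_mod_cast hn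
  have hS : 0 ≤ ∑ i, (|v i| / B) ^ p := Finset.sum_nonneg fun i _ => by positivity
  by_cases hq : q = ∞
  · subst hq
    rw [lqNorm, PiLp.norm_eq_ciSup]
    have h1 : (⨆ i, ‖v i‖) ≤ B := Real.iSup_le hv hB.le
    refine h1.trans ?_
    simp only [ENNReal.inv_top, ENNReal.toReal_zero, Real.rpow_zero, mul_one]
    exact le_mul_of_one_le_right hB.le (by linarith [div_nonneg hS hn'.le])
  set r := q.toReal with hr
  have hpr : p ≤ r := (ENNReal.ofReal_le_iff_le_toReal hq).1 hpq
  have hr0 : 0 < r := by linarith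
  rw [lqNorm, PiLp.norm_eq_sum hr0, ENNReal.toReal_inv, ← hr]
  set S := ∑ i, (|v i| / B) ^ p
  have h1 : ∑ i, ‖v i‖ ^ r ≤ B ^ r * S := by
    rw [Finset.mul_sum]
    refine Finset.sum_le_sum fun i _ => ?_
    have h2 : ‖v i‖ = B * (|v i| / B) := by rw [Real.norm_eq_abs]; field_simp
    rw [h2, Real.mul_rpow hB.le (by positivity)]
    gcongr ?_ * ?_
    rcases (abs_nonneg (v i)).eq_or_lt with h0 | h0
    · rw [← h0, zero_div, Real.zero_rpow hr0.ne', Real.zero_rpow (by linarith)]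
    · exact Real.rpow_le_rpow_of_exponent_ge (by positivity) ((div_le_one hB).2 (hv i)) hpr
  have h3 : (S / n) ^ (1 / r) ≤ 1 + S / n := by
    have hSn : 0 ≤ S / n := by positivity
    rcases le_total (S / n) 1 with h | h
    · linarith [Real.rpow_le_one hSn h (show 0 ≤ 1 / r by positivity)]
    · have := Real.rpow_le_rpow_of_exponent_le h
        (show 1 / r ≤ 1 by rw [div_le_one hr0]; linarith)
      rw [Real.rpow_one] at this
      linarith
  calc (∑ i, ‖v i‖ ^ r) ^ (1 / r) ≤ (B ^ r * S) ^ (1 / r) := by gcongr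
    _ = B * (n : ℝ) ^ r⁻¹ * (S / n) ^ (1 / r) := by
        rw [Real.mul_rpow (by positivity) hS, ← Real.rpow_mul hB.le, mul_one_div_cancel hr0.ne',
          Real.rpow_one, mul_assoc, ← one_div, ← Real.mul_rpow hn'.le (by positivity),
          mul_div_cancel₀ _ hn'.ne']
    _ ≤ _ := by gcongr

lemma measurable_lqNorm_apply {q : ℝ≥0∞} (hq : 1 ≤ q) (A : Matrix (Fin m) (Fin n) ℝ) (x₀ : E) :
    Measurable fun x : E => lqNorm q (apply A (x - x₀)) := by
  have : Fact (1 ≤ q) := ⟨hq⟩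
  have hc : Continuous fun x : E => apply A (x - x₀) := by
    refine continuous_pi fun i => ?_
    simp only [apply_eq_inner]
    fun_prop
  exact (((PiLp.continuous_toLp q _).comp hc).norm).measurable

lemma lqNorm_nonneg (q : ℝ≥0∞) (hq : 1 ≤ q) (v : Fin m → ℝ) : 0 ≤ lqNorm q v := by
  have : Fact (1 ≤ q) := ⟨hq⟩
  exact norm_nonneg _

/-- Conditioning on an event of probability at least `1 / 2` at most doubles integrals. -/
lemma lintegral_cond_le {Ω : Type*} [MeasurableSpace Ω] {μ : Measure Ω} {s : Set Ω}
    (hs : 2⁻¹ ≤ μ s) (F : Ω → ℝ≥0∞) : ∫⁻ x, F x ∂(μ[|s]) ≤ 2 * ∫⁻ x, F x ∂μ := by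
  rw [ProbabilityTheory.cond, lintegral_smul_measure, smul_eq_mul]
  refine mul_le_mul' ?_ (lintegral_mono' Measure.restrict_le_self le_rfl)
  exact ENNReal.inv_le_iff_inv_le.1 hs

/-- The moment bound for a finite exponent. -/
lemma lintegral_lqNorm_distribution_le {C₁ C₂ : ℝ} (hC₁ : 0 < C₁) (hC₁' : C₁ ≤ 1 / 128)
    (hC₂ : 0 < C₂) (hC₂' : C₂ ≤ 1 / 128) (hn : 1 ≤ n) {A : Matrix (Fin m) (Fin n) ℝ} {x₀ : E}
    (hx₀ : ∀ j, |x₀ j| ≤ 1) {p M K : ℝ} {q : ℝ≥0∞} (hp : 2 ≤ p) (hpq : ENNReal.ofReal p ≤ q)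
    (hM0 : 0 < M) (hM : ∀ j, ∑ i, |A i j| ^ p ≤ M ^ p) (hK₁ : 2 * Real.exp 32 ≤ K)
    (hK₂ : 1 / (√(2 * C₁) * C₂) ≤ K) :
    ∫⁻ x, ENNReal.ofReal (lqNorm q (apply A (x - x₀))) ∂(distribution C₁ C₂ A x₀) ≤
      ENNReal.ofReal (4 * (K * √p * M * (n : ℝ) ^ (1 / 2 - 1 / p)) * (n : ℝ) ^ (q⁻¹).toReal) := by
  have hn' : (0 : ℝ) < n := by exact_mod_cast hn
  have hp0 : 0 < p := by linarith
  have hK : 0 < K := lt_of_lt_of_le (by positivity) hK₁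
  set B := K * √p * M * (n : ℝ) ^ (1 / 2 - 1 / p) with hB
  have hB0 : 0 < B := by positivity
  obtain ⟨hΔ0, hΔ⟩ := radius_mem hC₁ hC₂ hn A
  -- Here `hK₂` gives `1 / (√(2 C₁) K) ≤ C₂ ≤ 1`, and a `p`-th power of such a number is still at
  -- most `C₂`.
  have hΔB : radius C₁ C₂ A ≤ B := by
    refine radius_le hB0.le ((rowSum_le_sum_rpow hC₁ hB0 hp0 A).trans ?_)
    have e : √(p / (2 * C₁)) = 1 / √(2 * C₁) * √p := by
      rw [Real.sqrt_div hp0.le]; ring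
    rw [e]
    refine (sum_norm_row_div_rpow_le hp hn hM0 hK (by positivity) hM).trans ?_
    gcongr
    have h1 : 1 / √(2 * C₁) / K ≤ C₂ := by
      rw [div_le_iff₀ hK]
      calc 1 / √(2 * C₁) = C₂ * (1 / (√(2 * C₁) * C₂)) := by field_simp
        _ ≤ C₂ * K := by gcongr
    have h2 : 1 / √(2 * C₁) / K ≤ 1 := by linarith
    calc (1 / √(2 * C₁) / K) ^ p ≤ (1 / √(2 * C₁) / K) ^ (1 : ℝ) :=
          Real.rpow_le_rpow_of_exponent_ge (by positivity) h2 (by linarith)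
      _ ≤ C₂ := by rwa [Real.rpow_one]
  have hprob := walkLaw_isPartialColoring_ge (x₀ := x₀) hn hΔ0 hx₀ hC₁' hC₂' hΔ
  refine (lintegral_cond_le hprob _).trans ?_
  set μ := walkLaw A x₀ (radius C₁ C₂ A) (8 * n)
  have hae : ∀ᵐ x ∂μ, x ∈ polytope A x₀ (radius C₁ C₂ A) :=
    ae_mem_polytope (mem_polytope_self hΔ0 hx₀) _
  set S : E → ℝ := fun x => ∑ i, (|apply A (x - x₀) i| / B) ^ p with hS
  have hSterm : ∀ i, Measurable fun x : E => (|apply A (x - x₀) i| / B) ^ p := fun i =>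
    (((measurable_apply A x₀ i).abs.div_const B).pow_const p)
  have hSm : Measurable S := Finset.measurable_fun_sum _ fun i _ => hSterm i
  have hS0 : ∀ x, 0 ≤ S x := fun x => Finset.sum_nonneg fun i _ => by positivity
  -- Here `hK₁` absorbs the constant `2 exp 32` of the moment bound. In the final factor `4`, one
  -- `2` is `1 + 1` from this estimate and the other comes from conditioning.
  have hSint : ∫⁻ x, ENNReal.ofReal (S x) ∂μ ≤ ENNReal.ofReal n := by
    have h1 : ∀ x, ENNReal.ofReal (S x) =
        ∑ i, ENNReal.ofReal ((|apply A (x - x₀) i| / B) ^ p) := fun x =>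
      ENNReal.ofReal_sum_of_nonneg fun i _ => by positivity
    simp only [h1]
    rw [lintegral_finsetSum _ fun i _ => (hSterm i).ennreal_ofReal]
    have h2 : ∀ i, ∫⁻ x, ENNReal.ofReal ((|apply A (x - x₀) i| / B) ^ p) ∂μ ≤
        ENNReal.ofReal ((2 * Real.exp 32 * √p * ‖row A i‖ / B) ^ p) := by
      intro i
      have h3 : ∀ x : E, ENNReal.ofReal ((|apply A (x - x₀) i| / B) ^ p) =
          ENNReal.ofReal ((B ^ p)⁻¹) * ENNReal.ofReal (|⟪row A i, x - x₀⟫| ^ p) := by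
        intro x
        rw [apply_eq_inner, ← ENNReal.ofReal_mul (by positivity), Real.div_rpow (abs_nonneg _) hB0.le,
          div_eq_inv_mul]
      simp only [h3]
      rw [lintegral_const_mul _ (by fun_prop)]
      refine (mul_le_mul_right (lintegral_abs_rpow_walkLaw_le hn (row A i)
        (by linarith : 1 ≤ p)) _).trans_eq ?_
      rw [← ENNReal.ofReal_mul (by positivity), Real.div_rpow (by positivity) hB0.le,
        div_eq_inv_mul]
    refine (Finset.sum_le_sum fun i _ => h2 i).trans ?_
    rw [← ENNReal.ofReal_sum_of_nonneg fun i _ => by positivity]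
    apply ENNReal.ofReal_le_ofReal
    refine (sum_norm_row_div_rpow_le hp hn hM0 hK (by positivity) hM).trans ?_
    exact mul_le_of_le_one_left hn'.le
      (Real.rpow_le_one (by positivity) ((div_le_one hK).2 hK₁) hp0.le)
  set D := B * (n : ℝ) ^ (q⁻¹).toReal with hD
  have hD0 : 0 ≤ D := by positivity
  have hpt : ∀ᵐ x ∂μ, ENNReal.ofReal (lqNorm q (apply A (x - x₀))) ≤
      ENNReal.ofReal D * (1 + ENNReal.ofReal (n : ℝ)⁻¹ * ENNReal.ofReal (S x)) := by
    filter_upwards [hae] with x hx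
    rw [← ENNReal.ofReal_mul (by positivity), ← ENNReal.ofReal_one,
      ← ENNReal.ofReal_add zero_le_one (mul_nonneg (by positivity) (hS0 x)),
      ← ENNReal.ofReal_mul hD0]
    apply ENNReal.ofReal_le_ofReal
    rw [← div_eq_inv_mul]
    exact lqNorm_le hn hB0 hp hpq fun i => (hx.2 i).trans hΔB
  calc 2 * ∫⁻ x, ENNReal.ofReal (lqNorm q (apply A (x - x₀))) ∂μ
      ≤ 2 * ∫⁻ x, ENNReal.ofReal D * (1 + ENNReal.ofReal (n : ℝ)⁻¹ * ENNReal.ofReal (S x)) ∂μ :=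
        mul_le_mul_right (lintegral_mono_ae hpt) _
    _ = 2 * (ENNReal.ofReal D *
          (1 + ENNReal.ofReal (n : ℝ)⁻¹ * ∫⁻ x, ENNReal.ofReal (S x) ∂μ)) := by
        rw [lintegral_const_mul _ (by fun_prop), lintegral_add_left measurable_const,
          lintegral_const_mul _ (by fun_prop), lintegral_one, measure_univ]
    _ ≤ 2 * (ENNReal.ofReal D * (1 + ENNReal.ofReal (n : ℝ)⁻¹ * ENNReal.ofReal n)) := by gcongr
    _ = ENNReal.ofReal (4 * D) := by
        rw [← ENNReal.ofReal_mul (by positivity), inv_mul_cancel₀ hn'.ne', ENNReal.ofReal_one,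
          show (2 : ℝ≥0∞) = ENNReal.ofReal 2 by simp, one_add_one_eq_two,
          show (2 : ℝ≥0∞) = ENNReal.ofReal 2 by simp, ← ENNReal.ofReal_mul hD0,
          ← ENNReal.ofReal_mul zero_le_two]
        congr 1
        ring
    _ = _ := by rw [hD, ← mul_assoc]

/-! ### The choice of the exponent -/

/-- Comparison of the `ℓ_r` norm and the `ℓ_p` norm for `r ≤ p`. -/
lemma sum_abs_rpow_le_of_lqNorm_le_one {v : Fin m → ℝ} {p : ℝ≥0∞} {r : ℝ} (hm : 1 ≤ m)
    (hr : 2 ≤ r) (hrp : ENNReal.ofReal r ≤ p) (hv : lqNorm p v ≤ 1) :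
    ∑ i, |v i| ^ r ≤ ((m : ℝ) ^ (1 / r - (p⁻¹).toReal)) ^ r := by
  have hm' : (0 : ℝ) < m := by exact_mod_cast hm
  have hr0 : 0 < r := by linarith
  rw [← Real.rpow_mul hm'.le, sub_mul, one_div_mul_cancel hr0.ne']
  by_cases hp : p = ∞
  · subst hp
    rw [lqNorm, PiLp.norm_eq_ciSup] at hv
    have hb : ∀ i, |v i| ≤ 1 := fun i =>
      (le_ciSup (f := fun i => ‖v i‖) (Set.finite_range _).bddAbove i).trans hv
    simp only [ENNReal.inv_top, ENNReal.toReal_zero, zero_mul, sub_zero, Real.rpow_one]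
    calc ∑ i, |v i| ^ r ≤ ∑ _i : Fin m, (1 : ℝ) :=
          Finset.sum_le_sum fun i _ => Real.rpow_le_one (abs_nonneg _) (hb i) hr0.le
      _ = m := by simp
  set P := p.toReal with hP
  have hrP : r ≤ P := (ENNReal.ofReal_le_iff_le_toReal hp).1 hrp
  have hP0 : 0 < P := by linarith
  rw [lqNorm, PiLp.norm_eq_sum hP0] at hv
  have hsum0 : 0 ≤ ∑ i, ‖v i‖ ^ P := Finset.sum_nonneg fun i _ => by positivity
  have hsum : ∑ i, |v i| ^ P ≤ 1 := by
    have := Real.rpow_le_rpow (by positivity) hv hP0.le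
    rwa [← Real.rpow_mul hsum0, one_div_mul_cancel hP0.ne', Real.rpow_one, Real.one_rpow] at this
  have hT0 : 0 ≤ ∑ i, |v i| ^ r := Finset.sum_nonneg fun i _ => by positivity
  have h1 := Real.rpow_sum_le_const_mul_sum_rpow (Finset.univ : Finset (Fin m))
    (fun i => |v i| ^ r) (show 1 ≤ P / r by rwa [one_le_div hr0])
  have e : ∀ i, |(|v i| ^ r)| ^ (P / r) = |v i| ^ P := by
    intro i
    rw [abs_of_nonneg (by positivity), ← Real.rpow_mul (abs_nonneg _), mul_div_cancel₀ _ hr0.ne']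
  have e' : ∀ i, |(|v i| ^ r)| = |v i| ^ r := fun i => abs_of_nonneg (by positivity)
  simp only [e] at h1
  simp only [e', Finset.card_univ, Fintype.card_fin] at h1
  have h2 : (∑ i, |v i| ^ r) ^ (P / r) ≤ (m : ℝ) ^ (P / r - 1) :=
    h1.trans (mul_le_of_le_one_right (by positivity) hsum)
  have h3 := Real.rpow_le_rpow (by positivity) h2 (show 0 ≤ r / P by positivity)
  rw [← Real.rpow_mul hT0, ← Real.rpow_mul hm'.le, div_mul_div_cancel₀ hr0.ne',
    div_self hP0.ne', Real.rpow_one] at h3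
  refine h3.trans_eq ?_
  rw [ENNReal.toReal_inv, ← hP]
  congr 1
  field_simp

lemma log_two_mul_div_ge (hn : 1 ≤ n) (hnm : n ≤ m) : Real.log 2 ≤ Real.log (2 * m / n) := by
  have hn' : (0 : ℝ) < n := by exact_mod_cast hn
  have hnm' : (n : ℝ) ≤ m := by exact_mod_cast hnm
  refine Real.log_le_log two_pos ?_
  rw [le_div_iff₀ hn']
  linarith

/-- With `L = log (2m/n)`, take `r = p` if `p ≤ max 2 L`, and `r = max 2 L` otherwise. As `L ≥ log 2
> 2/3`, both `2` and `L` are at most `3 L`. The final alternative records that either nothing was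
changed or `r` is large enough for `rpow_mul_rpow_le`. -/
lemma exists_exponent (hn : 1 ≤ n) (hnm : n ≤ m) {p : ℝ≥0∞} (hp : 2 ≤ p) :
    ∃ r : ℝ, 2 ≤ r ∧ ENNReal.ofReal r ≤ p ∧
      r ≤ 3 * (min p (ENNReal.ofReal (Real.log (2 * m / n)))).toReal ∧
      (1 / r = (p⁻¹).toReal ∨ Real.log (2 * m / n) ≤ r) := by
  set L := Real.log (2 * m / n)
  have hL : 0.69 ≤ L := by
    have := log_two_mul_div_ge hn hnm
    linarith [Real.log_two_gt_d9]
  have hmax : max 2 L ≤ 3 * L := max_le (by linarith) (by linarith)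
  rcases le_total p (ENNReal.ofReal (max 2 L)) with h | h
  · have hpt : p ≠ ∞ := ne_top_of_le_ne_top ENNReal.ofReal_ne_top h
    have hpL : p.toReal ≤ max 2 L := ENNReal.toReal_le_of_le_ofReal (by positivity) h
    refine ⟨p.toReal, ?_, ENNReal.ofReal_toReal_le, ?_, Or.inl ?_⟩
    · simpa using ENNReal.toReal_mono hpt hp
    · rw [ENNReal.toReal_min hpt ENNReal.ofReal_ne_top, ENNReal.toReal_ofReal (by linarith)]
      rcases min_choice p.toReal L with h' | h' <;> rw [h']
      · linarith [ENNReal.toReal_nonneg (a := p)]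
      · linarith
    · rw [ENNReal.toReal_inv, one_div]
  · refine ⟨max 2 L, le_max_left _ _, h, ?_, Or.inr (le_max_right _ _)⟩
    rw [min_eq_right ((ENNReal.ofReal_le_ofReal (le_max_right _ _)).trans h),
      ENNReal.toReal_ofReal (by linarith)]
    exact hmax

/-- The powers of `m` and `n` combine to `(m/n)^(1/r - κ)` times the target power, where `κ` stands
for `1/p`. The first factor is `1` if `r = p`, and otherwise at most `(m/n)^(1/r) ≤ e` because `log
(m/n) ≤ r`. -/
lemma rpow_mul_rpow_le (hn : 1 ≤ n) (hnm : n ≤ m) {r κ s : ℝ} (hr : 2 ≤ r) (hκ : 0 ≤ κ)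
    (h : 1 / r = κ ∨ Real.log (2 * m / n) ≤ r) :
    (m : ℝ) ^ (1 / r - κ) * (n : ℝ) ^ (1 / 2 - 1 / r) * (n : ℝ) ^ s ≤
      Real.exp 1 * (n : ℝ) ^ (1 / 2 - κ + s) := by
  have hn' : (0 : ℝ) < n := by exact_mod_cast hn
  have hm' : (0 : ℝ) < m := by exact_mod_cast hn.trans hnm
  have hr0 : 0 < r := by linarith
  have hquot : (1 : ℝ) ≤ m / n := by
    rw [one_le_div hn']; exact_mod_cast hnm
  have hqpos : (0 : ℝ) < m / n := by positivity
  have e : (m : ℝ) ^ (1 / r - κ) * (n : ℝ) ^ (1 / 2 - 1 / r) * (n : ℝ) ^ s =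
      ((m : ℝ) / n) ^ (1 / r - κ) * (n : ℝ) ^ (1 / 2 - κ + s) := by
    have h1 : (m : ℝ) ^ (1 / r - κ) = ((m : ℝ) / n) ^ (1 / r - κ) * (n : ℝ) ^ (1 / r - κ) := by
      rw [← Real.mul_rpow hqpos.le hn'.le, div_mul_cancel₀ _ hn'.ne']
    rw [h1, mul_assoc, mul_assoc, ← Real.rpow_add hn', ← Real.rpow_add hn']
    congr 2
    ring
  rw [e]
  gcongr
  rcases h with h | h
  · rw [h, sub_self, Real.rpow_zero]
    exact Real.one_le_exp zero_le_one
  · calc ((m : ℝ) / n) ^ (1 / r - κ) ≤ ((m : ℝ) / n) ^ (1 / r) :=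
          Real.rpow_le_rpow_of_exponent_le hquot (by linarith)
      _ = Real.exp (Real.log (m / n) / r) := by
          rw [Real.rpow_def_of_pos hqpos, mul_one_div]
      _ ≤ Real.exp 1 := by
          apply Real.exp_le_exp.2
          rw [div_le_one hr0]
          refine le_trans (Real.log_le_log hqpos ?_) h
          gcongr
          linarith

end LovettMeka

end

/-! ### Assembly of the theorem -/

theorem mainTheorem6 :
    ∃ c : ℝ, 0 < c ∧ ∀ C₁ C₂ : ℝ, 0 < C₁ → C₁ ≤ c → 0 < C₂ → C₂ ≤ c →
      ∃ C : ℝ, 0 < C ∧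
        ∀ (m n : ℕ), 1 ≤ n → n ≤ m →
        ∀ (A : Matrix (Fin m) (Fin n) ℝ) (x₀ : EuclideanSpace ℝ (Fin n)), (∀ j, |x₀ j| ≤ 1) →
          IsProbabilityMeasure (LovettMeka.distribution C₁ C₂ A x₀) ∧
          ∀ p q : ℝ≥0∞, 2 ≤ p → p ≤ q →
            (∀ j : Fin n, LovettMeka.lqNorm p (fun i => A i j) ≤ 1) →
            Integrable (fun x => LovettMeka.lqNorm q (LovettMeka.apply A (x - x₀)))
                (LovettMeka.distribution C₁ C₂ A x₀) ∧
              ∫ x, LovettMeka.lqNorm q (LovettMeka.apply A (x - x₀))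
                  ∂(LovettMeka.distribution C₁ C₂ A x₀) ≤
                C * Real.sqrt (min p (ENNReal.ofReal (Real.log (2 * m / n)))).toReal *
                  (n : ℝ) ^ (1 / 2 - (p⁻¹).toReal + (q⁻¹).toReal) := by
  -- For `C₁` the threshold is the exponent constant in `walkLaw_tail_le`; for `C₂` it is what
  -- Markov's inequality needs in `walkLaw_many_tight_le`.
  refine ⟨1 / 128, by norm_num, fun C₁ C₂ hC₁ hC₁' hC₂ hC₂' => ?_⟩
  set K : ℝ := 2 * Real.exp 32 + 1 / (√(2 * C₁) * C₂) with hK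
  have hK₁ : 2 * Real.exp 32 ≤ K := le_add_of_nonneg_right (by positivity)
  have hK₂ : 1 / (√(2 * C₁) * C₂) ≤ K := le_add_of_nonneg_left (by positivity)
  have hK0 : 0 < K := lt_of_lt_of_le (by positivity) hK₁
  refine ⟨4 * K * 2 * Real.exp 1, by positivity, fun m n hn hnm A x₀ hx₀ => ?_⟩
  have hm : 1 ≤ m := hn.trans hnm
  have hm' : (0 : ℝ) < m := by exact_mod_cast hm
  have hn' : (0 : ℝ) < n := by exact_mod_cast hn
  refine ⟨?_, fun p q hp hpq hA => ?_⟩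
  · obtain ⟨hΔ0, hΔ⟩ := LovettMeka.radius_mem hC₁ hC₂ hn A
    have h := LovettMeka.walkLaw_isPartialColoring_ge (x₀ := x₀) hn hΔ0 hx₀ hC₁' hC₂' hΔ
    exact ProbabilityTheory.cond_isProbabilityMeasure
      (lt_of_lt_of_le (by simp : (0 : ℝ≥0∞) < 2⁻¹) h).ne'
  have hq1 : 1 ≤ q := (one_le_two.trans hp).trans hpq
  obtain ⟨r, hr2, hrp, hrmin, hr⟩ := LovettMeka.exists_exponent hn hnm hp
  -- Here `M` bounds the `ℓ_r` norms of the columns, given that their `ℓ_p` norms are at most `1`.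
  have hbound := LovettMeka.lintegral_lqNorm_distribution_le hC₁ hC₁' hC₂ hC₂' hn hx₀ (q := q)
    (M := (m : ℝ) ^ (1 / r - (p⁻¹).toReal)) hr2 (hrp.trans hpq) (by positivity)
    (fun j => LovettMeka.sum_abs_rpow_le_of_lqNorm_le_one hm hr2 hrp (hA j)) hK₁ hK₂
  have hmeas := LovettMeka.measurable_lqNorm_apply hq1 A x₀
  have hnonneg : ∀ x, 0 ≤ LovettMeka.lqNorm q (LovettMeka.apply A (x - x₀)) := fun x =>
    LovettMeka.lqNorm_nonneg q hq1 _
  refine ⟨⟨hmeas.aestronglyMeasurable, ?_⟩, ?_⟩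
  · rw [hasFiniteIntegral_iff_ofReal (Filter.Eventually.of_forall hnonneg)]
    exact hbound.trans_lt ENNReal.ofReal_lt_top
  · rw [integral_eq_lintegral_of_nonneg_ae (Filter.Eventually.of_forall hnonneg)
      hmeas.aestronglyMeasurable]
    refine (ENNReal.toReal_le_of_le_ofReal (by positivity) hbound).trans ?_
    have hsqrt : √r ≤ 2 * √(min p (ENNReal.ofReal (Real.log (2 * m / n)))).toReal := by
      rw [Real.sqrt_le_left (by positivity), mul_pow, Real.sq_sqrt ENNReal.toReal_nonneg]
      linarith [ENNReal.toReal_nonneg (a := min p (ENNReal.ofReal (Real.log (2 * m / n))))]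
    have hpow := LovettMeka.rpow_mul_rpow_le hn hnm (s := (q⁻¹).toReal) hr2
      (ENNReal.toReal_nonneg (a := p⁻¹)) hr
    calc _ = 4 * K * √r * ((m : ℝ) ^ (1 / r - (p⁻¹).toReal) * (n : ℝ) ^ (1 / 2 - 1 / r) *
          (n : ℝ) ^ (q⁻¹).toReal) := by ring
      _ ≤ 4 * K * (2 * √(min p (ENNReal.ofReal (Real.log (2 * m / n)))).toReal) *
          (Real.exp 1 * (n : ℝ) ^ (1 / 2 - (p⁻¹).toReal + (q⁻¹).toReal)) := by gcongr
      _ = _ := by ring
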